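/- Let $a,b,c,d\in\mathbb C$ with $d\neq 0$ and $ad-bc+c^2\neq 0$, and let $\tilde\varphi:[x,y,z,t]\mapsto[x',y',z',t']$ be the birational map of $\mathbb{CP}^3$ given by $$x'=-a t^2-b(x+y)t-c(x+y+z)t-d(x+y)(2x+2y+z),\quad y'=x\,\ell,\quad z'=y\,\ell,\quad t'=t\,\ell,\qquad \ell=ct+d(x+y).$$ Its inverse is $\tilde\psi=\lambda\tilde\varphi\lambda$, with $\lambda[x,y,z,t]=[z,y,x,t]$. Let $p_0=[x,y,z,t]$ be the generic point (the coordinates being indeterminates), and let $p_k$ be the regularised $k$-th iterate of $p_0$: the $k$-fold composition of the homogeneous formulae of $\tilde\varphi$, with all common factors of the four components removed (it is defined up to a nonzero constant). For $E\in\mathbb C[x,y,z,t]$ write $\tilde\varphi^*(E)=E(x',y',z',t')$. There are polynomials $A_k$ $(k\ge 0)$ and $B_k$ $(k\geq 1)$ in $\mathbb C[x,y,z,t]$, with $A_0=x$, $A_1=x'$, $B_1=ct+d(x+y)$, such that $$p_1=[A_1,\,xB_1,\,yB_1,\,tB_1],\qquad p_k=[A_k,\;A_{k-1}B_k,\;A_{k-2}B_{k-1}B_k,\;tB_1B_2\cdots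 B_k]\quad(k\ge 2),$$ so that in particular the factored form is stable for $k\ge3$. With $p_k$ denoting these quadruples, and $\Gamma_k=tB_1\cdots B_k$, $D_k=A_k+A_{k-1}B_k$, $F_k=B_1B_2\cdots B_{k-3}\,B_{k-2}^2$, the following hold. (1) Direct image: $\tilde\varphi(p_k)=p_{k+1}$ for $k=0,1,2$ and $\tilde\varphi(p_k)=F_k\,p_{k+1}$ for $k\ge 3$. Consequently, for $k\ge 3$, $$d\,D_k+c\,\Gamma_k-F_k\,B_{k+1}=0,$$ $$A_{k+1}F_k+a\,\Gamma_k^2+B_kD_{k-1}(d\,D_k+c\,\Gamma_k)+D_k\bigl(b\,\Gamma_k+d(D_k+A_k)\bigr)+c\,A_k\Gamma_k=0 .$$ (2) Pull-back: there are integers $\alpha(k)\ge0$ $(k\ge0)$ and $\beta(k)\geq 0$ $(k\ge1)$ such that $$\tilde\varphi^*(A_k)=B_1^{\alpha(k)}A_{k+1},\qquad \tilde\varphi^*(B_k)=B_1^{\beta(k)}B_{k+1},\qquad \alpha(k)=\alpha(k-1)+\beta(k)\ (k\ge1),$$ where $B_1$ divides no $A_k$ and no $B_k$ with $k\ge2$;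 and, componentwise, $\tilde\varphi^*(p_k)=B_1^{\alpha(k)}p_{k+1}$ for $k\ge2$. (3) More generally, under pull-back the only extra factors are powers of $B_1$: put $C_1=ct+d(z+y)$. If $S=\{E=0\}$ is a surface with $E$ irreducible and homogeneous, not proportional to $C_1$, then $\tilde\varphi^*(E)=B_1^{\nu}E'$ for some integer $\nu\ge0$ and some irreducible $E'$ not divisible by $B_1$, and $E'$ is an equation of the image of $S$ by $\tilde\psi$ (it generates the ideal of polynomials vanishing at $\tilde\psi(q)$ for all $q\in S$ where $\tilde\psi$ is defined). For the plane $\{C_1=0\}$, which $\tilde\psi$ contracts, $\tilde\varphi^*(C_1)=B_1^2$. -/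

import Mathlib

open MvPolynomial

/-- Homogeneous coordinate ring of `ℂℙ³`; the coordinates `x, y, z, t` are
`X 0, X 1, X 2, X 3`. -/
abbrev HPoly : Type := MvPolynomial (Fin 4) ℂ

/-- The generic point `p₀ = [x, y, z, t]`. -/
noncomputable def genPt : Fin 4 → HPoly := fun i => X i

/-- The four quadratic formulae of the map `φ̃`, applied to a quadruple of elements of any
commutative `ℂ`-algebra (complex numbers, or polynomials). -/
def phi {S : Type*} [CommRing S] [Algebra ℂ S] (a b c d : ℂ) (v : Fin 4 → S) : Fin 4 → S :=
  let x := v 0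
  let y := v 1
  let z := v 2
  let t := v 3
  ![-(a • t ^ 2) - b • ((x + y) * t) - c • ((x + y + z) * t)
        - d • ((x + y) * (2 * x + 2 * y + z)),
    x * (c • t + d • (x + y)),
    y * (c • t + d • (x + y)),
    t * (c • t + d • (x + y))]

/-- The linear involution `λ : [x, y, z, t] ↦ [z, y, x, t]`. -/
def lam {S : Type*} (v : Fin 4 → S) : Fin 4 → S := ![v 2, v 1, v 0, v 3]

/-- The rational inverse `ψ̃ = λ · φ̃ · λ` of `φ̃`. -/
def psi {S : Type*} [CommRing S] [Algebra ℂ S] (a b c d : ℂ) (v : Fin 4 → S) : Fin 4 → S :=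
  lam (phi a b c d (lam v))

/-- The linear form `c t + d (x + y)` (the polynomial `B₁`). -/
noncomputable def formB (c d : ℂ) : HPoly := c • X 3 + d • (X 0 + X 1)

/-- The linear form `c t + d (z + y)` (the polynomial `C₁`). -/
noncomputable def formC (c d : ℂ) : HPoly := c • X 3 + d • (X 2 + X 1)

/-- The pull-back `φ̃^*(E)` of a polynomial `E`, i.e. `E` composed with the formulae of `φ̃`. -/
noncomputable def pullback (a b c d : ℂ) (E : HPoly) : HPoly :=
  aeval (phi a b c d genPt) E

/-- `P` is a determination of the regularised `k`-th iterate of the generic point: the `k`-fold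
composition of the homogeneous formulae is `F • P` with a nonzero polynomial `F`, and the four
components of `P` have no common factor left. -/
def IsRegularizedIterate (a b c d : ℂ) (k : ℕ) (P : Fin 4 → HPoly) : Prop :=
  (∃ F : HPoly, F ≠ 0 ∧ ∀ i, (phi a b c d)^[k] genPt i = F * P i) ∧
    ∀ f : HPoly, (∀ i, f ∣ P i) → IsUnit f

/-- `Γ_k = t B₁ B₂ ⋯ B_k`. -/
noncomputable def Gam (B : ℕ → HPoly) (k : ℕ) : HPoly := X 3 * ∏ j ∈ Finset.Icc 1 k, B j

/-- `D_k = A_k + A_{k-1} B_k` (used for `k ≥ 2`). -/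
noncomputable def Dpol (A B : ℕ → HPoly) (k : ℕ) : HPoly := A k + A (k - 1) * B k

/-- `B₁ B₂ ⋯ B_{k-3} B_{k-2}²`, the factor removed in the direct image (used for `k ≥ 3`). -/
noncomputable def directFactor (B : ℕ → HPoly) (k : ℕ) : HPoly :=
  (∏ j ∈ Finset.Icc 1 (k - 3), B j) * B (k - 2) ^ 2

/-- The quadruple `[A_k, A_{k-1} B_k, A_{k-2} B_{k-1} B_k, t B₁ ⋯ B_k]` (used for `k ≥ 2`). -/
noncomputable def stableForm (A B : ℕ → HPoly) (k : ℕ) : Fin 4 → HPoly :=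
  ![A k, A (k - 1) * B k, A (k - 2) * B (k - 1) * B k, Gam B k]

/-- The polynomial `E'` is an equation of the image of the surface `{E = 0}` by `ψ̃`: it generates
the ideal of all polynomials that vanish at the points `ψ̃(p)`, for `p` on `{E = 0}` at which `ψ̃`
is defined. -/
def IsImageEquation (a b c d : ℂ) (E E' : HPoly) : Prop :=
  ∀ G : HPoly,
    (∀ p : Fin 4 → ℂ, eval p E = 0 → psi a b c d p ≠ 0 → eval (psi a b c d p) G = 0) ↔ E' ∣ G

/-! In the affine chart `t = 1` the map shifts coordinates: from the second iterate on, the generic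
point becomes `[ξ_k, ξ_{k-1}, ξ_{k-2}, 1]`, where `ξ_k` is the `k`-th pull-back of `x / t`. If `σ_k`
denotes the `k`-th pull-back of `C₁ / t`, then `σ_{k+2} = c + d (ξ_{k+1} + ξ_k)`, and the dynamics
becomes the autonomous discrete Painlevé I equation `σ_{n+2} + σ_{n+1} + σ_n = m - κ / σ_{n+1}` with
`m = 4c - b` and `κ = ad - bc + c² ≠ 0` (`sigmaSeq_recurrence`).

Parts (1) and (2) rest on the orders of `σ_k` and `ξ_k` along the plane `B₁ = 0`. Singularity
confinement (`hasValue_of_recurrence`) gives `σ₁, …, σ₄` the orders `1, -1, -1, 1`, after which the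
recurrence restarts from the values `0, u` with `u` the value of `σ₀`. A later zero is excluded by
choosing `u`: as `u → ∞` the restarted orbit has explicit asymptotics of period three
(`tendsto_residueSeq`). Hence `σ_k` has order `0` for `k ≥ 5`, and `ξ_k` has order `-1` for `k ≥ 1`.

Let `A_k`, `B_k` be the iterated pull-backs of `x` and `B₁`, stripped of powers of `B₁`. The orders
force `ξ_k = A_k / Γ_k` (`algebraMap_A_eq`) and `σ_{n+4} = B_{n+1} B_{n+4} / (t B_{n+2} B_{n+3})`
(`sigmaSeq_add_four_mul`); the relations of (1) are the recurrences with denominators cleared.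

That no other factor appears comes from `ψ̃`: pulling back by `φ̃`, then by `ψ̃`, multiplies a form
of degree `n` by `C₁^{3n}`, and a polynomial prime to `B₁` whose `ψ̃`-pull-back divides a power of
`C₁` is constant (`isUnit_of_pullInv_dvd`). This yields both the coprimality of `A_k` and `Γ_k` and
part (3). -/

theorem lam_lam {S : Type*} (v : Fin 4 → S) : lam (lam v) = v := by
  ext i; fin_cases i <;> rfl

/-! ### The quadratic formulae and their composites -/

section formulae

variable {S T : Type*} [CommRing S] [Algebra ℂ S] [CommRing T] [Algebra ℂ T]

theorem phi_smul (a b c d : ℂ) (r : S) (v : Fin 4 → S) :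
    phi a b c d (r • v) = r ^ 2 • phi a b c d v := by
  ext i
  fin_cases i <;> simp [phi, Algebra.smul_def] <;> ring

theorem map_phi (a b c d : ℂ) (f : S →ₐ[ℂ] T) (v : Fin 4 → S) (i : Fin 4) :
    f (phi a b c d v i) = phi a b c d (fun j => f (v j)) i := by
  have h2 : f 2 = 2 := map_ofNat f 2
  fin_cases i <;> simp [phi, h2]

theorem map_lam (f : S →ₐ[ℂ] T) (v : Fin 4 → S) (i : Fin 4) :
    f (lam v i) = lam (fun j => f (v j)) i := by
  fin_cases i <;> simp [lam]

theorem map_psi (a b c d : ℂ) (f : S →ₐ[ℂ] T) (v : Fin 4 → S) (i : Fin 4) :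
    f (psi a b c d v i) = psi a b c d (fun j => f (v j)) i := by
  simp only [psi]
  rw [map_lam]
  congr 1
  funext j
  rw [map_phi]
  congr 1
  funext j
  rw [map_lam]

theorem psi_phi (a b c d : ℂ) (v : Fin 4 → S) :
    psi a b c d (phi a b c d v) = (c • v 3 + d • (v 0 + v 1)) ^ 3 • v := by
  ext i
  fin_cases i <;> simp [phi, psi, lam, Algebra.smul_def] <;> ring

theorem phi_psi (a b c d : ℂ) (v : Fin 4 → S) :
    phi a b c d (psi a b c d v) = (c • v 3 + d • (v 2 + v 1)) ^ 3 • v := by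
  have h := psi_phi a b c d (lam v)
  have h2 := congrArg lam h
  rw [psi, lam_lam] at h2
  rw [psi, h2]
  ext i
  fin_cases i <;> simp [lam]

theorem psi_smul (a b c d : ℂ) (r : S) (v : Fin 4 → S) :
    psi a b c d (r • v) = r ^ 2 • psi a b c d v := by
  have h (r : S) (v : Fin 4 → S) : lam (r • v) = r • lam v := by
    ext i; fin_cases i <;> simp [lam]
  rw [psi, h, phi_smul, h, psi]

end formulae

/-! ### Pull-backs and the planes `B₁ = 0`, `C₁ = 0` -/

/-- The pull-back by `φ̃` as an algebra homomorphism. -/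
noncomputable def pullHom (a b c d : ℂ) : HPoly →ₐ[ℂ] HPoly := aeval (phi a b c d genPt)

/-- The pull-back by `ψ̃` as an algebra homomorphism. -/
noncomputable def pullInv (a b c d : ℂ) : HPoly →ₐ[ℂ] HPoly := aeval (psi a b c d genPt)

theorem eval_pullHom (a b c d : ℂ) (p : Fin 4 → ℂ) (f : HPoly) :
    eval p (pullHom a b c d f) = eval (phi a b c d p) f := by
  have h : (aeval p).comp (pullHom a b c d) = aeval (R := ℂ) (phi a b c d p) := by
    ext i
    simp only [pullHom, AlgHom.comp_apply, aeval_X]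
    rw [map_phi]
    simp [genPt]
  simpa [aeval_eq_eval] using congrArg (fun g => g f) h

theorem eval_pullInv (a b c d : ℂ) (p : Fin 4 → ℂ) (f : HPoly) :
    eval p (pullInv a b c d f) = eval (psi a b c d p) f := by
  have h : (aeval p).comp (pullInv a b c d) = aeval (R := ℂ) (psi a b c d p) := by
    ext i
    simp only [pullInv, AlgHom.comp_apply, aeval_X]
    rw [map_psi]
    simp [genPt]
  simpa [aeval_eq_eval] using congrArg (fun g => g f) h

theorem eval_formB (c d : ℂ) (p : Fin 4 → ℂ) :
    eval p (formB c d) = c * p 3 + d * (p 0 + p 1) := by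
  simp [formB, smul_eval, mul_add]

theorem eval_formC (c d : ℂ) (p : Fin 4 → ℂ) :
    eval p (formC c d) = c * p 3 + d * (p 2 + p 1) := by
  simp [formC, smul_eval, mul_add]

theorem pullHom_formC (a b c d : ℂ) : pullHom a b c d (formC c d) = formB c d ^ 2 := by
  simp [pullHom, formC, formB, phi, genPt, Algebra.smul_def]; ring

theorem pullInv_formB (a b c d : ℂ) : pullInv a b c d (formB c d) = formC c d ^ 2 := by
  simp [pullInv, formC, formB, psi, lam, phi, genPt, Algebra.smul_def]; ring

theorem eval_formC_phi (a b c d : ℂ) (q : Fin 4 → ℂ) :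
    eval (phi a b c d q) (formC c d) = eval q (formB c d) ^ 2 := by
  rw [← eval_pullHom, pullHom_formC, map_pow]

theorem formB_isHomogeneous (c d : ℂ) : (formB c d).IsHomogeneous 1 := by
  simp only [formB, smul_eq_C_mul]
  exact ((isHomogeneous_X ℂ _).C_mul c).add
    (((isHomogeneous_X ℂ _).add (isHomogeneous_X ℂ _)).C_mul d)

theorem phi_genPt_isHomogeneous (a b c d : ℂ) (i : Fin 4) :
    (phi a b c d genPt i).IsHomogeneous 2 := by
  have hX (i : Fin 4) : (X i : HPoly).IsHomogeneous 1 := isHomogeneous_X ℂ i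
  have hB := formB_isHomogeneous c d
  fin_cases i
  · simp only [phi, genPt, smul_eq_C_mul, Fin.zero_eta, Matrix.cons_val_zero]
    rw [show (2 : HPoly) = C 2 from (map_ofNat C 2).symm]
    refine ((((?_ : IsHomogeneous _ 2).neg.sub ?_).sub ?_).sub ?_)
    · exact ((hX 3).pow 2).C_mul a
    · exact (((hX 0).add (hX 1)).mul (hX 3)).C_mul b
    · exact ((((hX 0).add (hX 1)).add (hX 2)).mul (hX 3)).C_mul c
    · exact (((hX 0).add (hX 1)).mul
        ((((hX 0).C_mul 2).add ((hX 1).C_mul 2)).add (hX 2))).C_mul d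
  · exact (hX 0).mul hB
  · exact (hX 1).mul hB
  · exact (hX 3).mul hB

theorem pullHom_isHomogeneous (a b c d : ℂ) {f : HPoly} {n : ℕ} (hf : f.IsHomogeneous n) :
    (pullHom a b c d f).IsHomogeneous (2 * n) :=
  hf.aeval _ (phi_genPt_isHomogeneous a b c d)

theorem eval_smul_of_isHomogeneous {σ R : Type*} [CommSemiring R] {f : MvPolynomial σ R} {n : ℕ}
    (hf : f.IsHomogeneous n) (r : R) (p : σ → R) : eval (r • p) f = r ^ n * eval p f := by
  rw [eval_eq, eval_eq, Finset.mul_sum]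
  refine Finset.sum_congr rfl fun e he => ?_
  simp only [Pi.smul_apply, smul_eq_mul, mul_pow, Finset.prod_mul_distrib,
    Finset.prod_pow_eq_pow_sum]
  rw [hf.degree_eq_sum_deg_support he]
  ring

/-- The composite of the two maps multiplies points by `C₁³`, and homogeneity of degree `n` turns
this scalar into its `n`-th power. -/
theorem pullInv_pullHom (a b c d : ℂ) {f : HPoly} {n : ℕ} (hf : f.IsHomogeneous n) :
    pullInv a b c d (pullHom a b c d f) = formC c d ^ (3 * n) * f := by
  refine MvPolynomial.funext fun p => ?_
  rw [eval_pullInv, eval_pullHom, phi_psi, map_mul, map_pow, eval_formC, pow_mul]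
  exact eval_smul_of_isHomogeneous hf _ _

theorem formB_ne_zero (c : ℂ) {d : ℂ} (hd : d ≠ 0) : formB c d ≠ 0 := by
  intro h
  have := eval_formB c d ![1, 0, 0, 0]
  simp [h] at this
  exact hd this.symm

theorem formC_ne_zero (c : ℂ) {d : ℂ} (hd : d ≠ 0) : formC c d ≠ 0 := by
  intro h
  have := eval_formC c d ![0, 0, 1, 0]
  simp [h] at this
  exact hd this.symm

theorem formC_isHomogeneous (c d : ℂ) : (formC c d).IsHomogeneous 1 := by
  simp only [formC, smul_eq_C_mul]
  exact ((isHomogeneous_X ℂ _).C_mul c).add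
    (((isHomogeneous_X ℂ _).add (isHomogeneous_X ℂ _)).C_mul d)

theorem irreducible_of_isHomogeneous_one {σ k : Type*} [Field k] {f : MvPolynomial σ k}
    (hf : f.IsHomogeneous 1) (h0 : f ≠ 0) : Irreducible f := by
  refine irreducible_of_totalDegree_eq_one (hf.totalDegree h0) fun x hx => ?_
  obtain ⟨i, hi⟩ := MvPolynomial.ne_zero_iff.1 h0
  refine isUnit_iff_ne_zero.2 fun h => hi ?_
  simpa [h] using hx i

theorem formB_prime (c : ℂ) {d : ℂ} (hd : d ≠ 0) : Prime (formB c d) :=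
  (irreducible_of_isHomogeneous_one (formB_isHomogeneous c d) (formB_ne_zero c hd)).prime

theorem formC_prime (c : ℂ) {d : ℂ} (hd : d ≠ 0) : Prime (formC c d) :=
  (irreducible_of_isHomogeneous_one (formC_isHomogeneous c d) (formC_ne_zero c hd)).prime

/-! ### Images of points and pull-backs of irreducible surfaces -/

/-- Points off the plane `B₁ = 0` are in the image of `ψ̃`. -/
theorem exists_psi_eq (a b c d : ℂ) (q : Fin 4 → ℂ) (hq : eval q (formB c d) ≠ 0) :
    ∃ (s : ℂ) (p : Fin 4 → ℂ), s ≠ 0 ∧ p = s • phi a b c d q ∧ psi a b c d p = q ∧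
      eval p (formC c d) ≠ 0 := by
  -- The formulae are quadratic, so rescaling the argument by a square root of `B₁(q)⁻³` normalises
  -- `ψ̃ φ̃ q = B₁(q)³ q` to `q` itself.
  obtain ⟨s, hs⟩ := IsAlgClosed.exists_pow_nat_eq ((eval q (formB c d) ^ 3)⁻¹) (n := 2) two_pos
  have hs0 : s ≠ 0 := by
    rintro rfl
    have : (eval q (formB c d) ^ 3)⁻¹ ≠ 0 := inv_ne_zero (pow_ne_zero _ hq)
    simp [← hs] at this
  refine ⟨s, s • phi a b c d q, hs0, rfl, ?_, ?_⟩
  · rw [psi_smul, psi_phi, hs, smul_smul, eval_formB]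
    rw [eval_formB] at hq
    simp only [smul_eq_mul]
    rw [inv_mul_cancel₀ (pow_ne_zero _ hq), one_smul]
  · rw [eval_smul_of_isHomogeneous (formC_isHomogeneous c d), eval_formC_phi]
    exact mul_ne_zero (pow_ne_zero _ hs0) (pow_ne_zero _ hq)

/-- Points off the plane `C₁ = 0` are in the image of `φ̃`. -/
theorem exists_phi_eq (a b c d : ℂ) (p : Fin 4 → ℂ) (hp : eval p (formC c d) ≠ 0) :
    ∃ q : Fin 4 → ℂ, phi a b c d q = p := by
  obtain ⟨s, hs⟩ := IsAlgClosed.exists_pow_nat_eq ((eval p (formC c d) ^ 3)⁻¹) (n := 2) two_pos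
  refine ⟨s • psi a b c d p, ?_⟩
  rw [phi_smul, phi_psi, hs, smul_smul, eval_formC]
  rw [eval_formC] at hp
  simp only [smul_eq_mul]
  rw [inv_mul_cancel₀ (pow_ne_zero _ hp), one_smul]

/-- Dominance of `φ̃`: a polynomial with zero pull-back vanishes on the image, which contains the
complement of `C₁ = 0`. -/
theorem pullHom_injective (a b c : ℂ) {d : ℂ} (hd : d ≠ 0) :
    Function.Injective (pullHom a b c d) := by
  rw [injective_iff_map_eq_zero]
  intro f hf
  have h : f * formC c d = 0 := by
    refine MvPolynomial.funext fun p => ?_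
    rw [map_mul, map_zero, mul_eq_zero]
    by_contra! h
    obtain ⟨q, hq⟩ := exists_phi_eq a b c d p h.2
    apply h.1
    rw [← hq, ← eval_pullHom, hf, map_zero]
  exact (mul_eq_zero.1 h).resolve_right (formC_ne_zero c hd)

/-- The Nullstellensatz for a hypersurface. -/
theorem exists_dvd_pow_of_eval_eq_zero {σ k : Type*} [Finite σ] [Field k] [IsAlgClosed k]
    {f g : MvPolynomial σ k} (h : ∀ p, eval p f = 0 → eval p g = 0) : ∃ n : ℕ, f ∣ g ^ n := by
  have hg : g ∈ vanishingIdeal k (zeroLocus k (Ideal.span {f})) := by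
    rw [mem_vanishingIdeal_iff]
    intro x hx
    rw [aeval_eq_eval]
    refine h x ?_
    have := mem_zeroLocus_iff.1 hx f (Ideal.mem_span_singleton_self f)
    simpa [aeval_eq_eval] using this
  rw [vanishingIdeal_zeroLocus_eq_radical] at hg
  obtain ⟨n, hn⟩ := hg
  exact ⟨n, Ideal.mem_span_singleton.1 hn⟩

/-- A polynomial whose pull-back by `ψ̃` divides a power of `C₁` divides a power of `B₁`. -/
theorem isUnit_of_pullInv_dvd (a b c : ℂ) {d : ℂ} (hd : d ≠ 0) {H : HPoly} {N : ℕ}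
    (h : pullInv a b c d H ∣ formC c d ^ N) (hH : ¬ formB c d ∣ H) : IsUnit H := by
  obtain ⟨n, hn⟩ : ∃ n : ℕ, H ∣ formB c d ^ n := by
    -- A zero of `H` off `B₁ = 0` would be `ψ̃(p)` with `C₁(p) ≠ 0`, while the divisibility makes a
    -- power of `C₁` vanish at `p`.
    refine exists_dvd_pow_of_eval_eq_zero fun q hq => ?_
    by_contra hB
    obtain ⟨s, p, -, -, hp, hC⟩ := exists_psi_eq a b c d q hB
    have h1 := (eval p).toMonoidHom.map_dvd h
    simp only [RingHom.toMonoidHom_eq_coe, MonoidHom.coe_coe, map_pow] at h1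
    rw [eval_pullInv, hp, hq, zero_dvd_iff] at h1
    exact pow_ne_zero _ hC h1
  obtain ⟨i, -, hi⟩ := (dvd_prime_pow (formB_prime c hd) n).1 hn
  rcases i with _ | i
  · simpa [associated_one_iff_isUnit] using hi
  · exact absurd (dvd_trans (dvd_pow_self _ (Nat.succ_ne_zero i)) hi.symm.dvd) hH

theorem exists_eq_pow_mul_and_not_dvd_of_prime {R : Type*} [CommRing R] [IsDomain R]
    [UniqueFactorizationMonoid R] {p f : R} (hp : Prime p) (hf : f ≠ 0) :
    ∃ (n : ℕ) (g : R), f = p ^ n * g ∧ ¬ p ∣ g := by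
  obtain ⟨g, h1, h2⟩ :=
    (FiniteMultiplicity.of_not_isUnit hp.not_isUnit hf).exists_eq_pow_mul_and_not_dvd
  exact ⟨_, g, h1, h2⟩

/-- The prime `E` divides the pull-back of one factor; cancelling it, the pull-back of the other
factor divides a power of `C₁`, so that factor is constant. -/
theorem isUnit_or_isUnit_of_pullInv_eq (a b c : ℂ) {d : ℂ} (hd : d ≠ 0) {E G H h : HPoly} {N : ℕ}
    (hE : Prime E) (hGH : pullInv a b c d (G * H) = E * h) (hh : h ∣ formC c d ^ N)
    (hB : ¬ formB c d ∣ G * H) : IsUnit G ∨ IsUnit H := by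
  have key : ∀ G H : HPoly, pullInv a b c d (G * H) = E * h → ¬ formB c d ∣ G * H →
      E ∣ pullInv a b c d G → IsUnit H := by
    rintro G H h1 h2 ⟨g, hg⟩
    rw [map_mul, hg, mul_assoc] at h1
    have h3 := mul_left_cancel₀ hE.ne_zero h1
    exact isUnit_of_pullInv_dvd a b c hd (((Dvd.intro_left g h3)).trans hh)
      fun h4 => h2 (h4.mul_left G)
  have hdvd : E ∣ pullInv a b c d G * pullInv a b c d H := by
    rw [← map_mul, hGH]; exact dvd_mul_right _ _
  rcases hE.dvd_or_dvd hdvd with h1 | h1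
  · exact Or.inr (key G H hGH hB h1)
  · exact Or.inl (key H G (mul_comm G H ▸ hGH) (mul_comm G H ▸ hB) h1)

theorem exists_pullback_eq_pow_mul_irreducible (a b c : ℂ) {d : ℂ} (hd : d ≠ 0) (E : HPoly) (n : ℕ)
    (hE : Irreducible E) (hn : E.IsHomogeneous n) (hC : ¬ Associated E (formC c d)) :
    ∃ (ν : ℕ) (E' : HPoly), Irreducible E' ∧ ¬ formB c d ∣ E' ∧
      pullback a b c d E = formB c d ^ ν * E' ∧ IsImageEquation a b c d E E' := by
  have hEp := hE.prime
  have hB := formB_prime c hd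
  obtain ⟨ν, E', hν, hE'⟩ := exists_eq_pow_mul_and_not_dvd_of_prime hB
    ((map_ne_zero_iff _ (pullHom_injective a b c hd)).2 hE.ne_zero)
  have hinv : formC c d ^ (2 * ν) * pullInv a b c d E' = formC c d ^ (3 * n) * E := by
    rw [← pullInv_pullHom a b c d hn, hν, map_mul, map_pow, pullInv_formB, pow_mul]
  have hEC (N : ℕ) : ¬ E ∣ formC c d ^ N := fun h =>
    hC (hEp.irreducible.associated_of_dvd (formC_prime c hd).irreducible (hEp.dvd_of_dvd_pow h))
  obtain ⟨h, hh⟩ : E ∣ pullInv a b c d E' :=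
    (hEp.dvd_or_dvd (hinv ▸ dvd_mul_left E _)).resolve_left (hEC _)
  have hhC : h ∣ formC c d ^ (3 * n) := by
    rw [hh, mul_left_comm, mul_comm _ E] at hinv
    exact Dvd.intro_left _ (mul_left_cancel₀ hE.ne_zero hinv)
  have hirr : Irreducible E' := by
    refine ⟨fun hu => hE.not_isUnit ?_, fun G H hGH => ?_⟩
    · exact isUnit_of_dvd_unit ⟨h, hh⟩ (hu.map (pullInv a b c d))
    · subst hGH
      exact isUnit_or_isUnit_of_pullInv_eq a b c hd hEp hh hhC hE'
  refine ⟨ν, E', hirr, hE', hν, fun G => ⟨fun hG => ?_, ?_⟩⟩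
  · obtain ⟨m, hm⟩ : ∃ m : ℕ, E' ∣ (G * formB c d) ^ m := by
      refine exists_dvd_pow_of_eval_eq_zero fun q hq => ?_
      rw [map_mul, mul_eq_zero, or_iff_not_imp_right]
      intro hBq
      obtain ⟨s, p, -, hsp, hp, -⟩ := exists_psi_eq a b c d q hBq
      rw [← hp]
      refine hG p ?_ ?_
      · rw [hsp, eval_smul_of_isHomogeneous hn, ← eval_pullHom, hν, map_mul, hq, mul_zero, mul_zero]
      · rw [hp]
        rintro rfl
        exact hBq (by rw [eval_formB]; simp)
    refine (hirr.prime.dvd_or_dvd (hirr.prime.dvd_of_dvd_pow hm)).resolve_right fun h1 => hE' ?_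
    exact (hirr.associated_of_dvd hB.irreducible h1).symm.dvd
  · rintro ⟨g, rfl⟩ p hp -
    rw [map_mul, ← eval_pullInv, hh, map_mul, hp, zero_mul, zero_mul]

/-! ### Nonvanishing of the orbit after confinement -/

section residue

open Filter Topology

/-- The autonomous first discrete Painlevé recurrence, with initial values `0` and `u`. -/
noncomputable def residueSeq (m κ u : ℂ) : ℕ → ℂ × ℂ
  | 0 => (0, u)
  | n + 1 => ((residueSeq m κ u n).2,
      m - κ / (residueSeq m κ u n).2 - (residueSeq m κ u n).2 - (residueSeq m κ u n).1)

theorem residueSeq_recurrence (m κ u : ℂ) (n : ℕ) :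
    (residueSeq m κ u (n + 2)).1 = m - κ / (residueSeq m κ u (n + 1)).1
      - (residueSeq m κ u (n + 1)).1 - (residueSeq m κ u n).1 := rfl

/-- With `u = 1 / w` and `w → 0`, the orbit repeats the pattern small, large, minus large: its terms
are asymptotic to `k(k+1)κ w`, `1/((k+1)w)`, `-1/((k+1)w)`. The coefficients of the large terms
never vanish, and that of the small one only at `k = 0`, the initial value. -/
theorem tendsto_residueSeq (m : ℂ) {κ : ℂ} (hκ : κ ≠ 0) (k : ℕ) :
    Tendsto (fun w : ℂ => w⁻¹ * (residueSeq m κ w⁻¹ (3 * k)).1) (𝓝[≠] 0)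
      (𝓝 (k * (k + 1) * κ)) ∧
    Tendsto (fun w : ℂ => w * (residueSeq m κ w⁻¹ (3 * k + 1)).1) (𝓝[≠] 0)
      (𝓝 (1 / (k + 1))) ∧
    Tendsto (fun w : ℂ => w * (residueSeq m κ w⁻¹ (3 * k + 2)).1) (𝓝[≠] 0)
      (𝓝 (-(1 / (k + 1)))) := by
  have hw : Tendsto (fun w : ℂ => w) (𝓝[≠] 0) (𝓝 0) := tendsto_id.mono_left nhdsWithin_le_nhds
  have hne : ∀ᶠ w : ℂ in 𝓝[≠] 0, w ≠ 0 := self_mem_nhdsWithin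
  have second (k : ℕ)
      (h0 : Tendsto (fun w : ℂ => w⁻¹ * (residueSeq m κ w⁻¹ (3 * k)).1) (𝓝[≠] 0)
        (𝓝 (k * (k + 1) * κ)))
      (h1 : Tendsto (fun w : ℂ => w * (residueSeq m κ w⁻¹ (3 * k + 1)).1) (𝓝[≠] 0)
        (𝓝 (1 / (k + 1)))) :
      Tendsto (fun w : ℂ => w * (residueSeq m κ w⁻¹ (3 * k + 2)).1) (𝓝[≠] 0)
        (𝓝 (-(1 / (k + 1)))) := by
    have hk : (1 / ((k : ℂ) + 1)) ≠ 0 := one_div_ne_zero (Nat.cast_add_one_ne_zero k)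
    have := (((hw.const_mul m).sub (((hw.pow 2).mul (h1.inv₀ hk)).const_mul κ)).sub h1).sub
      ((hw.pow 2).mul h0)
    refine (this.congr' ?_).trans (by simp)
    filter_upwards [hne] with w hw0
    rw [residueSeq_recurrence]
    field_simp
  induction k with
  | zero =>
    have h0 : Tendsto (fun w : ℂ => w⁻¹ * (residueSeq m κ w⁻¹ (3 * 0)).1) (𝓝[≠] 0)
        (𝓝 ((0 : ℕ) * ((0 : ℕ) + 1) * κ)) := by simp [residueSeq]
    have h1 : Tendsto (fun w : ℂ => w * (residueSeq m κ w⁻¹ (3 * 0 + 1)).1) (𝓝[≠] 0)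
        (𝓝 (1 / ((0 : ℕ) + 1))) := by
      refine tendsto_const_nhds.congr' ?_
      filter_upwards [hne] with w hw0
      simp [residueSeq, hw0]
    exact ⟨h0, h1, second 0 h0 h1⟩
  | succ k ih =>
    obtain ⟨h0, h1, h2⟩ := ih
    have hk0 : ((k : ℂ) + 1) ≠ 0 := Nat.cast_add_one_ne_zero k
    have hk1 : ((k : ℂ) + 2) ≠ 0 := by exact_mod_cast (Nat.succ_ne_zero (k + 1))
    have hk : (1 / ((k : ℂ) + 1)) ≠ 0 := one_div_ne_zero hk0
    have h3 : Tendsto (fun w : ℂ => w⁻¹ * (residueSeq m κ w⁻¹ (3 * (k + 1))).1) (𝓝[≠] 0)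
        (𝓝 (((k + 1 : ℕ) : ℂ) * ((k + 1 : ℕ) + 1) * κ)) := by
      -- Subtracting two consecutive recurrences removes `m` and the large terms: `s_{3k+3} = κ /
      -- s_{3k+1} + s_{3k} - κ / s_{3k+2}`.
      have := (((h1.inv₀ hk).const_mul κ).add h0).sub
        ((h2.inv₀ (neg_ne_zero.2 hk)).const_mul κ)
      have hlim : κ * (1 / ((k : ℂ) + 1))⁻¹ + k * (k + 1) * κ - κ * (-(1 / ((k : ℂ) + 1)))⁻¹
          = ((k + 1 : ℕ) : ℂ) * ((k + 1 : ℕ) + 1) * κ := by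
        push_cast; field_simp; ring
      rw [hlim] at this
      refine this.congr' ?_
      filter_upwards [hne] with w hw0
      have e3 : 3 * (k + 1) = 3 * k + 1 + 2 := by ring
      rw [e3, residueSeq_recurrence m κ w⁻¹ (3 * k + 1), residueSeq_recurrence m κ w⁻¹ (3 * k)]
      simp only [mul_inv]
      ring
    have h4 : Tendsto (fun w : ℂ => w * (residueSeq m κ w⁻¹ (3 * (k + 1) + 1)).1) (𝓝[≠] 0)
        (𝓝 (1 / (((k + 1 : ℕ) : ℂ) + 1))) := by
      have hne3 : ((k + 1 : ℕ) : ℂ) * ((k + 1 : ℕ) + 1) * κ ≠ 0 := by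
        push_cast
        rw [add_assoc, one_add_one_eq_two]
        exact mul_ne_zero (mul_ne_zero hk0 hk1) hκ
      have := (((hw.const_mul m).sub ((h3.inv₀ hne3).const_mul κ)).sub
        ((hw.pow 2).mul h3)).sub h2
      have hlim : m * 0 - κ * (((k + 1 : ℕ) : ℂ) * ((k + 1 : ℕ) + 1) * κ)⁻¹
          - 0 ^ 2 * (((k + 1 : ℕ) : ℂ) * ((k + 1 : ℕ) + 1) * κ) - -(1 / ((k : ℂ) + 1))
          = 1 / (((k + 1 : ℕ) : ℂ) + 1) := by
        push_cast
        rw [add_assoc, one_add_one_eq_two]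
        field_simp; ring
      rw [hlim] at this
      refine this.congr' ?_
      filter_upwards [hne] with w hw0
      have e3 : 3 * (k + 1) + 1 = 3 * k + 2 + 2 := by ring
      rw [e3, residueSeq_recurrence m κ w⁻¹ (3 * k + 2), show 3 * (k + 1) = 3 * k + 2 + 1 by ring]
      simp only [mul_inv, inv_inv, mul_sub]
      field_simp
    exact ⟨h3, h4, second (k + 1) h3 h4⟩

theorem exists_residueSeq_ne_zero (m : ℂ) {κ : ℂ} (hκ : κ ≠ 0) (N : ℕ) :
    ∃ u : ℂ, ∀ n, 1 ≤ n → n ≤ N → (residueSeq m κ u n).1 ≠ 0 := by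
  have hev : ∀ n ∈ Finset.Icc 1 N, ∀ᶠ w : ℂ in 𝓝[≠] 0, (residueSeq m κ w⁻¹ n).1 ≠ 0 := by
    intro n hn
    have h1 := (Finset.mem_Icc.1 hn).1
    obtain ⟨k, hk | hk | hk⟩ : ∃ k, n = 3 * (k + 1) ∨ n = 3 * k + 1 ∨ n = 3 * k + 2 :=
      ⟨(n - 1) / 3, by omega⟩
    · have hne : ((k + 1 : ℕ) : ℂ) * ((k + 1 : ℕ) + 1) * κ ≠ 0 :=
        mul_ne_zero (mul_ne_zero (Nat.cast_ne_zero.2 k.succ_ne_zero)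
          (Nat.cast_add_one_ne_zero _)) hκ
      filter_upwards [(tendsto_residueSeq m hκ (k + 1)).1.eventually_ne hne] with w hw
      exact hk ▸ right_ne_zero_of_mul hw
    · filter_upwards [(tendsto_residueSeq m hκ k).2.1.eventually_ne
        (one_div_ne_zero (Nat.cast_add_one_ne_zero k))] with w hw
      exact hk ▸ right_ne_zero_of_mul hw
    · filter_upwards [(tendsto_residueSeq m hκ k).2.2.eventually_ne
        (neg_ne_zero.2 (one_div_ne_zero (Nat.cast_add_one_ne_zero k)))] with w hw
      exact hk ▸ right_ne_zero_of_mul hw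
  obtain ⟨w, hw⟩ := ((Filter.eventually_all_finset _).2 hev).exists
  exact ⟨w⁻¹, fun n h1 h2 => hw n (Finset.mem_Icc.2 ⟨h1, h2⟩)⟩

end residue

/-! ### Values of fractions at a point, and singularity confinement -/

section value

variable {R K L : Type*} [CommRing R] [Field K] [Algebra R K] [Field L]

/-- The element `x` of the field `K` is a fraction of elements of `R` whose denominator is not
killed by `ev`, and `ev` takes it to `r`. -/
def HasValue (ev : R →+* L) (x : K) (r : L) : Prop :=
  ∃ f g : R, ev g ≠ 0 ∧ x * algebraMap R K g = algebraMap R K f ∧ ev f = r * ev g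

theorem hasValue_algebraMap (ev : R →+* L) (f : R) : HasValue ev (algebraMap R K f) (ev f) :=
  ⟨f, 1, by simp, by simp, by simp⟩

theorem HasValue.of_eq {ev : R →+* L} {x y : K} {r s : L} (h : HasValue ev x r) (hx : x = y)
    (hr : r = s) : HasValue ev y s := hx ▸ hr ▸ h

theorem HasValue.add {ev : R →+* L} {x y : K} {r s : L} (hx : HasValue ev x r)
    (hy : HasValue ev y s) : HasValue ev (x + y) (r + s) := by
  obtain ⟨f, g, hg, hx, hf⟩ := hx
  obtain ⟨f', g', hg', hy, hf'⟩ := hy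
  refine ⟨f * g' + f' * g, g * g', ?_, ?_, ?_⟩
  · rw [map_mul]; exact mul_ne_zero hg hg'
  · simp only [map_mul, map_add, ← hx, ← hy]; ring
  · simp only [map_mul, map_add, hf, hf']; ring

theorem HasValue.mul {ev : R →+* L} {x y : K} {r s : L} (hx : HasValue ev x r)
    (hy : HasValue ev y s) : HasValue ev (x * y) (r * s) := by
  obtain ⟨f, g, hg, hx, hf⟩ := hx
  obtain ⟨f', g', hg', hy, hf'⟩ := hy
  refine ⟨f * f', g * g', ?_, ?_, ?_⟩
  · rw [map_mul]; exact mul_ne_zero hg hg'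
  · simp only [map_mul, ← hx, ← hy]; ring
  · simp only [map_mul, hf, hf']; ring

theorem HasValue.neg {ev : R →+* L} {x : K} {r : L} (hx : HasValue ev x r) :
    HasValue ev (-x) (-r) := by
  obtain ⟨f, g, hg, hx, hf⟩ := hx
  exact ⟨-f, g, hg, by rw [neg_mul, hx, map_neg], by rw [map_neg, hf, neg_mul]⟩

theorem HasValue.sub {ev : R →+* L} {x y : K} {r s : L} (hx : HasValue ev x r)
    (hy : HasValue ev y s) : HasValue ev (x - y) (r - s) := by
  simpa only [sub_eq_add_neg] using hx.add hy.neg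

variable [FaithfulSMul R K]

theorem algebraMap_ne_zero_of_map_ne_zero {ev : R →+* L} {g : R} (hg : ev g ≠ 0) :
    algebraMap R K g ≠ 0 := by
  rw [Ne, FaithfulSMul.algebraMap_eq_zero_iff]
  rintro rfl
  exact hg (map_zero ev)

theorem HasValue.inv {ev : R →+* L} {x : K} {r : L} (hx : HasValue ev x r) (hr : r ≠ 0) :
    HasValue ev x⁻¹ r⁻¹ := by
  obtain ⟨f, g, hg, hx, hf⟩ := hx
  have hf0 : ev f ≠ 0 := hf ▸ mul_ne_zero hr hg
  have hx0 : x ≠ 0 := by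
    rintro rfl
    rw [zero_mul] at hx
    exact algebraMap_ne_zero_of_map_ne_zero hf0 hx.symm
  refine ⟨g, f, hf0, ?_, ?_⟩
  · rw [← hx]; field_simp
  · rw [hf]; field_simp

theorem HasValue.div {ev : R →+* L} {x y : K} {r s : L} (hx : HasValue ev x r)
    (hy : HasValue ev y s) (hs : s ≠ 0) : HasValue ev (x / y) (r / s) := by
  simpa only [div_eq_mul_inv] using hx.mul (hy.inv hs)

theorem HasValue.ne_zero {ev : R →+* L} {x : K} {r : L} (hx : HasValue ev x r) (hr : r ≠ 0) :
    x ≠ 0 := by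
  obtain ⟨f, g, hg, hx, hf⟩ := hx
  rintro rfl
  rw [zero_mul] at hx
  exact algebraMap_ne_zero_of_map_ne_zero (hf ▸ mul_ne_zero hr hg) hx.symm

/-- Singularity confinement for the recurrence `s (n + 2) + s (n + 1) + s n = m - κ / s (n + 1)`
when `s 1` vanishes. -/
theorem hasValue_of_recurrence {ev : R →+* ℂ} {s : ℕ → K} {M k : K} {m κ u : ℂ}
    (hM : HasValue ev M m) (hk : HasValue ev k κ) (hκ : κ ≠ 0) (h0 : HasValue ev (s 0) u)
    (h1 : HasValue ev (s 1) 0) (hs1 : s 1 ≠ 0)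
    (hs : ∀ n, s (n + 2) + s (n + 1) + s n = M - k / s (n + 1)) :
    HasValue ev (s 2 * s 1) (-κ) ∧ HasValue ev (s 3 * s 1) κ ∧ HasValue ev (s 4 / s 1) (-1) ∧
    ∀ n, (∀ j, 1 ≤ j → j < n → (residueSeq m κ u j).1 ≠ 0) →
      HasValue ev (s (n + 4)) (residueSeq m κ u n).1 := by
  have hk0 : k ≠ 0 := hk.ne_zero hκ
  have e2 : s 2 = M - k / s 1 - s 1 - s 0 := by rw [← hs 0]; ring
  have e3 : s 3 = M - k / s 2 - s 2 - s 1 := by rw [← hs 1]; ring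
  have e4 : s 4 = M - k / s 3 - s 3 - s 2 := by rw [← hs 2]; ring
  have e5 : s 5 = M - k / s 4 - s 4 - s 3 := by rw [← hs 3]; ring
  generalize he : s 1 = e at *
  generalize hu : s 0 = v at *
  -- `P2`, `P3`, `P4` will be `s 2 * e`, `s 3 * e`, `s 4 / e`: the terms with their pole or zero in
  -- `e` scaled away, so that each has a finite nonzero value.
  have p2 : HasValue ev ((M - v - e) * e - k) (-κ) :=
    ((((hM.sub h0).sub h1).mul h1).sub hk).of_eq rfl (by ring)
  have q2 : s 2 = ((M - v - e) * e - k) / e := by rw [e2]; field_simp; ring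
  generalize hP2 : (M - v - e) * e - k = P2 at *
  have hP20 : P2 ≠ 0 := p2.ne_zero (neg_ne_zero.2 hκ)
  have p3 : HasValue ev (k + v * e - k * e * e / P2) κ :=
    ((hk.add (h0.mul h1)).sub (((hk.mul h1).mul h1).div p2 (neg_ne_zero.2 hκ))).of_eq rfl
      (by simp)
  have q3 : s 3 = (k + v * e - k * e * e / P2) / e := by
    rw [e3, q2]
    field_simp
    rw [← hP2]
    ring
  generalize hP3 : k + v * e - k * e * e / P2 = P3 at *
  have hP30 : P3 ≠ 0 := p3.ne_zero hκ
  have p4 : HasValue ev (1 + k / P2 - k / P3) (-1) := by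
    have h := ((hasValue_algebraMap (K := K) ev 1).add (hk.div p2 (neg_ne_zero.2 hκ))).sub
      (hk.div p3 hκ)
    refine h.of_eq (by simp) ?_
    rw [map_one, div_neg, div_self hκ]
    ring
  have q4 : s 4 = (1 + k / P2 - k / P3) * e := by
    -- Eliminating `s 3 + s 2` cancels the poles of these two terms and leaves `s 4` proportional to
    -- `e`.
    have h3 : s 3 + s 2 = M - k / s 2 - e := by rw [e3]; ring
    have : s 4 = k / s 2 + e - k / s 3 := by rw [e4, sub_sub, h3]; ring
    rw [this, q2, q3]
    field_simp
    ring
  generalize hP4 : 1 + k / P2 - k / P3 = P4 at *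
  have hP40 : P4 ≠ 0 := p4.ne_zero (neg_ne_zero.2 one_ne_zero)
  -- Confinement: the poles of `k / s 4` and `s 3` cancel because `k + P3 * P4 = P3 * (P2 + k) / P2`
  -- and `P2 + k` is a multiple of `e`. The initial value `v` survives in the quotient, so its value
  -- `u` is recovered.
  have q5 : s 5 = M - e * P4 - P3 * (M - v - e) / (P2 * P4) := by
    have hPP : P3 * P4 * P2 = P3 * P2 + k * P3 - k * P2 := by
      rw [← hP4]; field_simp
    have hR : P2 + k = (M - v - e) * e := by rw [← hP2]; ring
    rw [e5, q4, q3]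
    field_simp
    linear_combination (-1 : K) * hPP - P3 * hR
  have p5 : HasValue ev (s 5) u := by
    rw [q5]
    refine ((hM.sub (h1.mul p4)).sub ((p3.mul ((hM.sub h0).sub h1)).div (p2.mul p4) ?_)).of_eq
      rfl ?_
    · simpa using hκ
    · field_simp; ring
  refine ⟨p2.of_eq (by rw [q2]; field_simp) rfl, p3.of_eq (by rw [q3]; field_simp) rfl,
    p4.of_eq (by rw [q4]; field_simp) rfl, fun n => ?_⟩
  induction n using Nat.twoStepInduction with
  | zero => exact fun _ => (p4.mul h1).of_eq q4.symm (by simp [residueSeq])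
  | one => exact fun _ => p5
  | more n ih1 ih2 =>
    intro hn
    have a1 := ih1 fun j hj1 hj2 => hn j hj1 (by omega)
    have a2 := ih2 fun j hj1 hj2 => hn j hj1 (by omega)
    have hne := hn (n + 1) (by omega) (by omega)
    rw [residueSeq_recurrence]
    refine (((hM.sub (hk.div a2 hne)).sub a2).sub a1).of_eq ?_ rfl
    have := hs (n + 4)
    rw [show n + 1 + 4 = n + 4 + 1 by ring, show n + 2 + 4 = n + 4 + 2 by ring,
      sub_sub, sub_sub, sub_eq_iff_eq_add.1 this.symm]
    ring

end value

/-! ### Stripping powers of `B₁` from homogeneous pull-backs -/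

theorem isHomogeneous_of_mul_left {σ R : Type*} [CommRing R] [IsDomain R] {f g : MvPolynomial σ R}
    {m N : ℕ} (hf : f.IsHomogeneous m) (hf0 : f ≠ 0) (hfg : (f * g).IsHomogeneous N) :
    ∃ j, g.IsHomogeneous j := by
  have key (j : ℕ) : homogeneousComponent (m + j) (f * g) = f * homogeneousComponent j g := by
    conv_lhs => rw [← sum_homogeneousComponent g, Finset.mul_sum, map_sum]
    rw [Finset.sum_eq_single j]
    · exact homogeneousComponent_of_mem (hf.mul (homogeneousComponent_isHomogeneous j g)) |>.trans
        (if_pos rfl)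
    · intro i _ hij
      refine (homogeneousComponent_of_mem
        (hf.mul (homogeneousComponent_isHomogeneous i g))).trans (if_neg ?_)
      omega
    · intro hj
      rw [homogeneousComponent_eq_zero j g (by simpa using hj), mul_zero, map_zero]
  by_cases h : ∃ j, m + j = N
  · obtain ⟨j, rfl⟩ := h
    refine ⟨j, ?_⟩
    have h1 := key j
    rw [homogeneousComponent_eq_self hfg] at h1
    rw [mul_left_cancel₀ hf0 h1]
    exact homogeneousComponent_isHomogeneous j g
  · refine ⟨0, ?_⟩
    have : g = 0 := by
      rw [← sum_homogeneousComponent g]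
      refine Finset.sum_eq_zero fun j _ => ?_
      have h1 := key j
      rw [homogeneousComponent_of_mem hfg, if_neg (fun h' => h ⟨j, h'⟩)] at h1
      exact (mul_eq_zero.1 h1.symm).resolve_left hf0
    rw [this]
    exact isHomogeneous_zero _ _ _

/-- Iterated pull-backs of `f`, with the powers of `B₁` removed at each step. -/
theorem exists_strippedPullback (a b c : ℂ) {d : ℂ} (hd : d ≠ 0) {f : HPoly} {n : ℕ} (hf : f ≠ 0)
    (hn : f.IsHomogeneous n) :
    ∃ (A : ℕ → HPoly) (α : ℕ → ℕ), A 0 = f ∧ (∀ k, A k ≠ 0) ∧ (∀ k, ∃ m, (A k).IsHomogeneous m) ∧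
      (∀ k, pullHom a b c d (A k) = formB c d ^ α k * A (k + 1)) ∧
      ∀ k, ¬ formB c d ∣ A (k + 1) := by
  have h (g : HPoly) : ∃ (i : ℕ) (g' : HPoly), g ≠ 0 →
      pullHom a b c d g = formB c d ^ i * g' ∧ ¬ formB c d ∣ g' := by
    by_cases hg : g = 0
    · exact ⟨0, 0, fun h => absurd hg h⟩
    · obtain ⟨i, g', h⟩ := exists_eq_pow_mul_and_not_dvd_of_prime (formB_prime c hd)
        ((map_ne_zero_iff _ (pullHom_injective a b c hd)).2 hg)
      exact ⟨i, g', fun _ => h⟩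
  choose ν τ hτ using h
  have h0 (k : ℕ) : τ^[k] f ≠ 0 := by
    induction k with
    | zero => exact hf
    | succ k ih =>
      rw [Function.iterate_succ_apply']
      intro h
      apply (hτ _ ih).2
      rw [h]
      exact dvd_zero _
  refine ⟨fun k => τ^[k] f, fun k => ν (τ^[k] f), rfl, h0, fun k => ?_, fun k => ?_, fun k => ?_⟩
  · induction k with
    | zero => exact ⟨n, hn⟩
    | succ k ih =>
      obtain ⟨m, hm⟩ := ih
      have h1 := pullHom_isHomogeneous a b c d hm
      rw [(hτ _ (h0 k)).1] at h1
      simp only [Function.iterate_succ_apply']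
      exact isHomogeneous_of_mul_left ((formB_isHomogeneous c d).pow _)
        (pow_ne_zero _ (formB_ne_zero c hd)) h1
  · simp only [Function.iterate_succ_apply']
    exact (hτ _ (h0 k)).1
  · simp only [Function.iterate_succ_apply']
    exact (hτ _ (h0 k)).2

/-! ### Order zero along a prime -/

section order

variable {R K L : Type*} [CommRing R] [Field K] [Algebra R K] [Field L]

/-- `x` is a fraction whose numerator and denominator are not divisible by `p`. -/
def IsUnitAt (p : R) (x : K) : Prop :=
  ∃ f g : R, ¬ p ∣ f ∧ ¬ p ∣ g ∧ x * algebraMap R K g = algebraMap R K f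

/-- A finite nonzero value at a single point of `p = 0` already shows that `p` divides neither
numerator nor denominator. Orders are thus read off from one well-chosen point. -/
theorem HasValue.isUnitAt {ev : R →+* L} {x : K} {r : L} {p : R} (hx : HasValue ev x r)
    (hr : r ≠ 0) (hp : ev p = 0) : IsUnitAt p x := by
  obtain ⟨f, g, hg, hx, hf⟩ := hx
  refine ⟨f, g, ?_, ?_, hx⟩
  · rintro ⟨y, rfl⟩
    rw [map_mul, hp, zero_mul] at hf
    exact mul_ne_zero hr hg hf.symm
  · rintro ⟨y, rfl⟩
    rw [map_mul, hp, zero_mul] at hg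
    exact hg rfl

theorem pow_mul_inj_of_not_dvd [IsDomain R] {p f g : R} {i j : ℕ} (hp : p ≠ 0) (hf : ¬ p ∣ f)
    (hg : ¬ p ∣ g) (h : p ^ i * f = p ^ j * g) : i = j := by
  wlog hij : i ≤ j generalizing i j f g
  · exact (this hg hf h.symm (by omega)).symm
  obtain ⟨n, rfl⟩ := Nat.exists_eq_add_of_le hij
  rw [pow_add, mul_assoc] at h
  have h1 := mul_left_cancel₀ (pow_ne_zero i hp) h
  rcases n with _ | n
  · rfl
  · exact absurd (h1 ▸ ((dvd_pow_self p n.succ_ne_zero).mul_right g)) hf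

theorem IsUnitAt.exponent_eq [IsDomain R] [FaithfulSMul R K] {p f g : R} {x : K} {i j : ℕ}
    (hx : IsUnitAt p x) (hp : Prime p) (hf : ¬ p ∣ f) (hg : ¬ p ∣ g)
    (h : algebraMap R K (p ^ i * f) = x * algebraMap R K (p ^ j * g)) : i = j := by
  obtain ⟨f', g', hf', hg', hx⟩ := hx
  refine pow_mul_inj_of_not_dvd hp.ne_zero (f := f * g') (g := g * f') ?_ ?_ ?_
  · exact fun h => (hp.dvd_or_dvd h).elim hf hg'
  · exact fun h => (hp.dvd_or_dvd h).elim hg hf'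
  · apply FaithfulSMul.algebraMap_injective R K
    rw [← mul_assoc, ← mul_assoc, map_mul, h, map_mul _ _ f', ← hx]
    ring

end order

/-! ### The affine sequences `ξ`, `σ` and their orders along `B₁ = 0` -/

/-- The extension of the pull-back by `φ̃` to the field of rational functions. -/
noncomputable def pullFrac (a b c : ℂ) {d : ℂ} (hd : d ≠ 0) :
    FractionRing HPoly →+* FractionRing HPoly :=
  IsFractionRing.lift (A := HPoly)
    (g := (algebraMap HPoly (FractionRing HPoly)).comp (pullHom a b c d).toRingHom)
    ((IsFractionRing.injective HPoly (FractionRing HPoly)).comp (pullHom_injective a b c hd))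

local notation "ι" => algebraMap HPoly (FractionRing HPoly)

theorem pullFrac_algebraMap (a b c : ℂ) {d : ℂ} (hd : d ≠ 0) (f : HPoly) :
    pullFrac a b c hd (ι f) = ι (pullHom a b c d f) := by
  simp [pullFrac]

/-- The iterated pull-backs of the affine coordinate `x / t`. -/
noncomputable def xiSeq (a b c : ℂ) {d : ℂ} (hd : d ≠ 0) (n : ℕ) : FractionRing HPoly :=
  (pullFrac a b c hd)^[n] (ι (X 0) / ι (X 3))

/-- The iterated pull-backs of the affine form `C₁ / t`. -/
noncomputable def sigmaSeq (a b c : ℂ) {d : ℂ} (hd : d ≠ 0) (n : ℕ) : FractionRing HPoly :=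
  (pullFrac a b c hd)^[n] (ι (formC c d) / ι (X 3))

section sequences

variable (a b c : ℂ) {d : ℂ} (hd : d ≠ 0)

theorem xiSeq_succ (n : ℕ) : xiSeq a b c hd (n + 1) = pullFrac a b c hd (xiSeq a b c hd n) := by
  rw [xiSeq, Function.iterate_succ_apply', xiSeq]

theorem sigmaSeq_succ (n : ℕ) :
    sigmaSeq a b c hd (n + 1) = pullFrac a b c hd (sigmaSeq a b c hd n) := by
  rw [sigmaSeq, Function.iterate_succ_apply', sigmaSeq]

theorem pullHom_X_zero : pullHom a b c d (X 0) = phi a b c d genPt 0 := by simp [pullHom]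

theorem pullHom_X_one : pullHom a b c d (X 1) = X 0 * formB c d := by
  simp [pullHom, phi, genPt, formB]

theorem pullHom_X_three : pullHom a b c d (X 3) = X 3 * formB c d := by
  simp [pullHom, phi, genPt, formB]

theorem pullHom_C (r : ℂ) : pullHom a b c d (C r) = C r := by
  simp [pullHom]

theorem algebraMap_X_ne_zero (i : Fin 4) : ι (X i) ≠ 0 := by
  rw [Ne, FaithfulSMul.algebraMap_eq_zero_iff]
  exact X_ne_zero i

theorem algebraMap_formB_ne_zero (c : ℂ) {d : ℂ} (hd : d ≠ 0) : ι (formB c d) ≠ 0 := by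
  rw [Ne, FaithfulSMul.algebraMap_eq_zero_iff]
  exact formB_ne_zero c hd

theorem sigmaSeq_one : sigmaSeq a b c hd 1 = ι (formB c d) / ι (X 3) := by
  have h3 := algebraMap_X_ne_zero 3
  have hB := algebraMap_formB_ne_zero c hd
  rw [sigmaSeq_succ, sigmaSeq, Function.iterate_zero_apply, map_div₀, pullFrac_algebraMap,
    pullFrac_algebraMap, pullHom_formC, pullHom_X_three]
  simp only [map_mul, map_pow]
  field_simp

theorem pullHom_formB_eq : pullHom a b c d (formB c d) =
    C c * (X 3 * formB c d) + C d * (phi a b c d genPt 0 + X 0 * formB c d) := by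
  rw [← pullHom_X_three a b, ← pullHom_X_zero, ← pullHom_X_one a b, formB]
  simp [smul_eq_C_mul, mul_add]

/-- The polynomial source of the Painlevé recurrence: dividing by `t B₁` gives its case `n = 0`, and
the other cases are pull-backs of that one. -/
theorem pullHom_formB_add : pullHom a b c d (formB c d) + formB c d ^ 2 + formC c d * formB c d =
    C (4 * c - b) * (X 3 * formB c d) - C (a * d - b * c + c ^ 2) * X 3 ^ 2 := by
  rw [pullHom_formB_eq]
  have h4 : (C 4 : HPoly) = 4 := map_ofNat C 4
  simp [phi, genPt, formB, formC, smul_eq_C_mul, h4]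
  ring

theorem sigmaSeq_two : sigmaSeq a b c hd 2 =
    ι (pullHom a b c d (formB c d)) / (ι (X 3) * ι (formB c d)) := by
  rw [sigmaSeq_succ, sigmaSeq_one, map_div₀, pullFrac_algebraMap, pullFrac_algebraMap,
    pullHom_X_three, map_mul]

theorem pullFrac_C (r : ℂ) : pullFrac a b c hd (ι (C r)) = ι (C r) := by
  rw [pullFrac_algebraMap, pullHom_C]

theorem sigmaSeq_recurrence (n : ℕ) :
    sigmaSeq a b c hd (n + 2) + sigmaSeq a b c hd (n + 1) + sigmaSeq a b c hd n =
      ι (C (4 * c - b)) - ι (C (a * d - b * c + c ^ 2)) / sigmaSeq a b c hd (n + 1) := by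
  induction n with
  | zero =>
    have h3 := algebraMap_X_ne_zero 3
    have hB := algebraMap_formB_ne_zero c hd
    have h := congrArg ι (pullHom_formB_add a b c (d := d))
    rw [sigmaSeq_two, sigmaSeq_one, sigmaSeq, Function.iterate_zero_apply]
    simp only [map_add, map_sub, map_mul, map_pow] at h ⊢
    field_simp
    linear_combination h
  | succ n ih =>
    have h := congrArg (pullFrac a b c hd) ih
    simpa only [map_add, map_sub, map_div₀, pullFrac_C, ← sigmaSeq_succ] using h

theorem sigmaSeq_eq_xiSeq (n : ℕ) : sigmaSeq a b c hd (n + 2) =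
    ι (C c) + ι (C d) * (xiSeq a b c hd (n + 1) + xiSeq a b c hd n) := by
  induction n with
  | zero =>
    have h3 := algebraMap_X_ne_zero 3
    have hB := algebraMap_formB_ne_zero c hd
    rw [sigmaSeq_two, xiSeq_succ, xiSeq, Function.iterate_zero_apply, map_div₀,
      pullFrac_algebraMap, pullFrac_algebraMap, pullHom_X_three, pullHom_X_zero, pullHom_formB_eq]
    simp only [map_add, map_mul]
    field_simp
  | succ n ih =>
    have h := congrArg (pullFrac a b c hd) ih
    simpa only [map_add, map_mul, pullFrac_C, ← sigmaSeq_succ, ← xiSeq_succ] using h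

theorem sigmaSeq_one_ne_zero : sigmaSeq a b c hd 1 ≠ 0 := by
  rw [sigmaSeq_one]
  exact div_ne_zero (algebraMap_formB_ne_zero c hd) (algebraMap_X_ne_zero 3)

theorem exists_point_hasValue (hdeg : a * d - b * c + c ^ 2 ≠ 0) (N : ℕ) :
    ∃ q : Fin 4 → ℂ, eval q (formB c d) = 0 ∧
      HasValue (eval q) (sigmaSeq a b c hd 1) 0 ∧
      HasValue (eval q) (sigmaSeq a b c hd 2 * sigmaSeq a b c hd 1) (-(a * d - b * c + c ^ 2)) ∧
      HasValue (eval q) (sigmaSeq a b c hd 3 * sigmaSeq a b c hd 1) (a * d - b * c + c ^ 2) ∧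
      HasValue (eval q) (sigmaSeq a b c hd 4 / sigmaSeq a b c hd 1) (-1) ∧
      (∃ r : ℂ, HasValue (eval q) (xiSeq a b c hd 0) r) ∧
      ∀ n ≤ N, ∃ r : ℂ, HasValue (eval q) (sigmaSeq a b c hd (n + 4)) r ∧ (1 ≤ n → r ≠ 0) := by
  obtain ⟨u, hu⟩ := exists_residueSeq_ne_zero (4 * c - b) hdeg N
  -- Chosen with `t = 1`, `B₁(q) = 0` and `C₁(q) = u`, so that `σ₁` and `σ₀` take the values `0` and
  -- `u`.
  let q : Fin 4 → ℂ := ![-c / d, 0, (u - c) / d, 1]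
  have hB : eval q (formB c d) = 0 := by
    rw [eval_formB]; simp [q]; field_simp; ring
  have hC : eval q (formC c d) = u := by
    rw [eval_formC]; simp [q]; field_simp; ring
  have h3 : eval q (X 3) = 1 := by simp [q]
  have v3 : HasValue (eval q) (ι (X 3)) 1 := h3 ▸ hasValue_algebraMap _ _
  have v0 : HasValue (eval q) (sigmaSeq a b c hd 0) u :=
    ((hC ▸ hasValue_algebraMap (eval q) (formC c d) : HasValue _ _ u).div v3 one_ne_zero).of_eq
      rfl (div_one u)
  have v1 : HasValue (eval q) (sigmaSeq a b c hd 1) 0 :=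
    ((hB ▸ hasValue_algebraMap (eval q) (formB c d) : HasValue _ _ (0 : ℂ)).div v3
      one_ne_zero).of_eq (sigmaSeq_one a b c hd).symm (div_one 0)
  have vC (r : ℂ) : HasValue (eval q) (ι (C r)) r := by
    simpa using hasValue_algebraMap (K := FractionRing HPoly) (eval q) (C r)
  obtain ⟨w2, w3, w4, w⟩ := hasValue_of_recurrence (vC (4 * c - b)) (vC _) hdeg v0 v1
    (sigmaSeq_one_ne_zero a b c hd) (sigmaSeq_recurrence a b c hd)
  refine ⟨q, hB, v1, w2, w3, w4, ⟨_, (hasValue_algebraMap (eval q) (X 0)).div v3 one_ne_zero⟩,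
    fun n hn => ⟨_, w n fun j hj1 hj2 => hu j hj1 (by omega), fun h1 => hu n h1 hn⟩⟩

theorem isUnitAt_sigmaSeq_two_mul (hdeg : a * d - b * c + c ^ 2 ≠ 0) :
    IsUnitAt (formB c d) (sigmaSeq a b c hd 2 * sigmaSeq a b c hd 1) := by
  obtain ⟨q, hB, -, h, -⟩ := exists_point_hasValue a b c hd hdeg 0
  exact h.isUnitAt (neg_ne_zero.2 hdeg) hB

theorem isUnitAt_sigmaSeq_three_mul (hdeg : a * d - b * c + c ^ 2 ≠ 0) :
    IsUnitAt (formB c d) (sigmaSeq a b c hd 3 * sigmaSeq a b c hd 1) := by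
  obtain ⟨q, hB, -, -, h, -⟩ := exists_point_hasValue a b c hd hdeg 0
  exact h.isUnitAt hdeg hB

theorem isUnitAt_sigmaSeq_four_div (hdeg : a * d - b * c + c ^ 2 ≠ 0) :
    IsUnitAt (formB c d) (sigmaSeq a b c hd 4 / sigmaSeq a b c hd 1) := by
  obtain ⟨q, hB, -, -, -, h, -⟩ := exists_point_hasValue a b c hd hdeg 0
  exact h.isUnitAt (neg_ne_zero.2 one_ne_zero) hB

theorem isUnitAt_sigmaSeq (hdeg : a * d - b * c + c ^ 2 ≠ 0) (n : ℕ) :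
    IsUnitAt (formB c d) (sigmaSeq a b c hd (n + 5)) := by
  obtain ⟨q, hB, -, -, -, -, -, h⟩ := exists_point_hasValue a b c hd hdeg (n + 1)
  obtain ⟨r, hr, hr0⟩ := h (n + 1) le_rfl
  exact hr.isUnitAt (hr0 (by omega)) hB

/-- Solving `σ_{k+2} = c + d (ξ_{k+1} + ξ_k)` for `ξ_{k+1}` gives the values of `ξ_k σ₁`
successively: `-κ/d`, then `2κ/d` from the two poles `σ₂`, `σ₃`. Afterwards `σ` is regular, so only
the sign alternates and the simple pole of `ξ` persists. -/
theorem isUnitAt_xiSeq_mul (hdeg : a * d - b * c + c ^ 2 ≠ 0) (n : ℕ) :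
    IsUnitAt (formB c d) (xiSeq a b c hd (n + 1) * sigmaSeq a b c hd 1) := by
  obtain ⟨q, hB, h1, h2, h3, -, ⟨r0, hx0⟩, h⟩ := exists_point_hasValue a b c hd hdeg n
  have vC (r : ℂ) : HasValue (eval q) (ι (C r)) r := by
    simpa using hasValue_algebraMap (K := FractionRing HPoly) (eval q) (C r)
  have hd' : ι (C d) ≠ 0 := (vC d).ne_zero hd
  have step (k : ℕ) {r s : ℂ}
      (hs : HasValue (eval q) (sigmaSeq a b c hd (k + 2) * sigmaSeq a b c hd 1) s)
      (hx : HasValue (eval q) (xiSeq a b c hd k * sigmaSeq a b c hd 1) r) :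
      HasValue (eval q) (xiSeq a b c hd (k + 1) * sigmaSeq a b c hd 1) (s / d - r) := by
    refine (((hs.sub ((vC c).mul h1)).div (vC d) hd).sub hx).of_eq ?_ (by simp)
    rw [sigmaSeq_eq_xiSeq]
    field_simp
    ring
  have x1 := step 0 h2 (hx0.mul h1)
  have x2 := step 1 h3 x1
  have hx (k : ℕ) (hk : k + 1 ≤ n) : HasValue (eval q)
      (xiSeq a b c hd (k + 2) * sigmaSeq a b c hd 1)
      ((-1) ^ k * (2 * (a * d - b * c + c ^ 2) / d)) := by
    induction k with
    | zero => exact x2.of_eq rfl (by ring)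
    | succ k ih =>
      obtain ⟨r, hr, -⟩ := h k (by omega)
      exact (step (k + 2) (hr.mul h1) (ih (by omega))).of_eq rfl (by ring)
  rcases n with _ | n
  · refine x1.isUnitAt ?_ hB
    rw [mul_zero, sub_zero]
    exact div_ne_zero (neg_ne_zero.2 hdeg) hd
  · refine (hx n le_rfl).isUnitAt ?_ hB
    exact mul_ne_zero (pow_ne_zero _ (neg_ne_zero.2 one_ne_zero))
      (div_ne_zero (mul_ne_zero two_ne_zero hdeg) hd)

end sequences

/-! ### Factorisation of `ξ` and `σ` through the stripped polynomials -/

theorem IsUnitAt.cancel {R K : Type*} [CommRing R] [Field K] [Algebra R K] [IsDomain R]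
    [FaithfulSMul R K] {p f g : R} {x : K} {i j : ℕ}
    (hx : IsUnitAt p x) (hp : Prime p) (hf : ¬ p ∣ f) (hg : ¬ p ∣ g)
    (h : algebraMap R K (p ^ i * f) = x * algebraMap R K (p ^ j * g)) :
    i = j ∧ algebraMap R K f = x * algebraMap R K g := by
  have hij := hx.exponent_eq hp hf hg h
  subst hij
  refine ⟨rfl, mul_left_cancel₀ (a := algebraMap R K (p ^ i)) ?_ ?_⟩
  · rw [Ne, FaithfulSMul.algebraMap_eq_zero_iff]
    exact pow_ne_zero _ hp.ne_zero
  · rw [← map_mul, h, map_mul]; ring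

/-- The iterated pull-backs of `x` and of `B₁`, with the powers of `B₁` removed. -/
structure StrippedOrbit (a b c d : ℂ) (A B : ℕ → HPoly) (α β : ℕ → ℕ) : Prop where
  A_zero : A 0 = X 0
  B_one : B 1 = formB c d
  A_isHomogeneous : ∀ k, ∃ m, (A k).IsHomogeneous m
  B_isHomogeneous : ∀ k, ∃ m, (B (k + 1)).IsHomogeneous m
  pullHom_A : ∀ k, pullHom a b c d (A k) = formB c d ^ α k * A (k + 1)
  pullHom_B : ∀ k, pullHom a b c d (B (k + 1)) = formB c d ^ β (k + 1) * B (k + 2)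
  not_dvd_A : ∀ k, ¬ formB c d ∣ A k
  not_dvd_B : ∀ k, ¬ formB c d ∣ B (k + 2)

theorem not_formB_dvd_of_eval_ne_zero {c d : ℂ} (p : Fin 4 → ℂ) {f : HPoly}
    (hp : eval p (formB c d) = 0) (hf : eval p f ≠ 0) : ¬ formB c d ∣ f := by
  rintro ⟨g, rfl⟩
  rw [map_mul, hp, zero_mul] at hf
  exact hf rfl

theorem not_formB_dvd_X_zero (c d : ℂ) : ¬ formB c d ∣ X 0 :=
  not_formB_dvd_of_eval_ne_zero ![1, -1, 0, 0] (by simp [eval_formB]) (by simp)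

theorem not_formB_dvd_X_three (c : ℂ) {d : ℂ} (hd : d ≠ 0) : ¬ formB c d ∣ X 3 :=
  not_formB_dvd_of_eval_ne_zero ![-c / d, 0, 0, 1] (by simp [eval_formB]; field_simp; ring)
    (by simp)

theorem exists_strippedOrbit (a b c : ℂ) {d : ℂ} (hd : d ≠ 0) :
    ∃ (A B : ℕ → HPoly) (α β : ℕ → ℕ), StrippedOrbit a b c d A B α β := by
  obtain ⟨A, α, hA0, -, hAh, hA, hA'⟩ :=
    exists_strippedPullback a b c hd (X_ne_zero 0) (isHomogeneous_X ℂ 0)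
  obtain ⟨B, β, hB0, -, hBh, hB, hB'⟩ :=
    exists_strippedPullback a b c hd (formB_ne_zero c hd) (formB_isHomogeneous c d)
  -- The shift makes the sequence `B` start at index `1`; its entry at `0` is never used.
  refine ⟨A, fun k => B (k - 1), α, fun k => β (k - 1), hA0, hB0, hAh, hBh, hA, hB, ?_, hB'⟩
  rintro (_ | k)
  · rw [hA0]; exact not_formB_dvd_X_zero c d
  · exact hA' k

theorem Gam_zero (B : ℕ → HPoly) : Gam B 0 = X 3 := by simp [Gam]

theorem Gam_succ (B : ℕ → HPoly) (k : ℕ) : Gam B (k + 1) = Gam B k * B (k + 1) := by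
  rw [Gam, Gam, Finset.prod_Icc_succ_top (by omega), mul_assoc]

namespace StrippedOrbit

variable {a b c d : ℂ} {A B : ℕ → HPoly} {α β : ℕ → ℕ}

theorem pullHom_Gam (h : StrippedOrbit a b c d A B α β) (k : ℕ) :
    pullHom a b c d (Gam B k) = formB c d ^ (∑ j ∈ Finset.Icc 1 k, β j) * Gam B (k + 1) := by
  induction k with
  | zero => simp [Gam_succ, Gam_zero, pullHom_X_three, h.B_one]
  | succ k ih =>
    rw [Gam_succ, map_mul, ih, h.pullHom_B, Finset.sum_Icc_succ_top (by omega), pow_add,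
      Gam_succ B (k + 1)]
    ring

theorem exists_Gam_eq (h : StrippedOrbit a b c d A B α β) (hd : d ≠ 0) (k : ℕ) :
    ∃ g, Gam B (k + 1) = formB c d * g ∧ ¬ formB c d ∣ g := by
  induction k with
  | zero =>
    exact ⟨X 3, by rw [Gam_succ, Gam_zero, h.B_one, mul_comm], not_formB_dvd_X_three c hd⟩
  | succ k ih =>
    obtain ⟨g, hg, hg'⟩ := ih
    refine ⟨g * B (k + 2), by rw [Gam_succ, hg, mul_assoc], fun hdvd => ?_⟩
    exact ((formB_prime c hd).dvd_or_dvd hdvd).elim hg' (h.not_dvd_B k)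

/-- Pulling back the identity for `k` gives the one for `k + 1` up to a power of `B₁`. That power is
trivial: `ξ_{k+1}` has a simple pole along `B₁ = 0` and `Γ_{k+1}` contains `B₁` exactly once. -/
theorem algebraMap_A_eq (h : StrippedOrbit a b c d A B α β) (hd : d ≠ 0)
    (hdeg : a * d - b * c + c ^ 2 ≠ 0) (k : ℕ) :
    ι (A k) = xiSeq a b c hd k * ι (Gam B k) := by
  induction k with
  | zero =>
    have h3 := algebraMap_X_ne_zero 3
    rw [h.A_zero, Gam_zero, xiSeq, Function.iterate_zero_apply]
    field_simp
  | succ k ih =>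
    have h3 := algebraMap_X_ne_zero 3
    obtain ⟨g, hg, hg'⟩ := h.exists_Gam_eq hd k
    have h1 := congrArg (pullFrac a b c hd) ih
    rw [map_mul, ← xiSeq_succ, pullFrac_algebraMap, pullFrac_algebraMap, h.pullHom_A,
      h.pullHom_Gam, hg] at h1
    have h2 := (isUnitAt_xiSeq_mul a b c hd hdeg k).cancel (formB_prime c hd)
      (h.not_dvd_A (k + 1)) (g := X 3 * g)
      (fun hdvd => ((formB_prime c hd).dvd_or_dvd hdvd).elim (not_formB_dvd_X_three c hd) hg')
      (h1.trans (by
        rw [sigmaSeq_one]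
        simp only [map_mul, map_pow]
        field_simp))
    rw [h2.2, hg, sigmaSeq_one]
    simp only [map_mul]
    field_simp

theorem alpha_eq_sum (h : StrippedOrbit a b c d A B α β) (hd : d ≠ 0)
    (hdeg : a * d - b * c + c ^ 2 ≠ 0) (k : ℕ) : α k = ∑ j ∈ Finset.Icc 1 k, β j := by
  have h1 := congrArg (pullFrac a b c hd) (h.algebraMap_A_eq hd hdeg k)
  rw [map_mul, ← xiSeq_succ, pullFrac_algebraMap, pullFrac_algebraMap, h.pullHom_A,
    h.pullHom_Gam, map_mul, map_mul, h.algebraMap_A_eq hd hdeg (k + 1), mul_left_comm] at h1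
  have hne : xiSeq a b c hd (k + 1) * ι (Gam B (k + 1)) ≠ 0 := by
    rw [← h.algebraMap_A_eq hd hdeg (k + 1), Ne, FaithfulSMul.algebraMap_eq_zero_iff]
    intro h0
    exact h.not_dvd_A (k + 1) (h0 ▸ dvd_zero _)
  have h2 := (mul_right_cancel₀ hne (by linear_combination h1) :
    ι (formB c d ^ α k) = ι (formB c d ^ (∑ j ∈ Finset.Icc 1 k, β j)))
  have hp := formB_prime c hd
  exact pow_mul_inj_of_not_dvd hp.ne_zero (f := 1) (g := 1) hp.not_dvd_one hp.not_dvd_one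
    (by simpa using FaithfulSMul.algebraMap_injective HPoly (FractionRing HPoly) h2)

theorem sigmaSeq_two_mul (h : StrippedOrbit a b c d A B α β) (hd : d ≠ 0)
    (hdeg : a * d - b * c + c ^ 2 ≠ 0) :
    β 1 = 0 ∧ sigmaSeq a b c hd 2 * (ι (X 3) * ι (B 1)) = ι (B 2) := by
  have h3 := algebraMap_X_ne_zero 3
  have hB := algebraMap_formB_ne_zero c hd
  have hp := formB_prime c hd
  have ht := not_formB_dvd_X_three c hd
  have e : sigmaSeq a b c hd 2 * (ι (X 3) * ι (B 1)) = ι (formB c d ^ β 1 * B 2) := by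
    rw [← h.pullHom_B 0, h.B_one, sigmaSeq_two]
    field_simp
  have h1 := (isUnitAt_sigmaSeq_two_mul a b c hd hdeg).cancel hp (i := β 1) (j := 0)
    (h.not_dvd_B 0) (g := X 3 ^ 2) (fun hdvd => ht (hp.dvd_of_dvd_pow hdvd))
    (by
      rw [← e, sigmaSeq_one, h.B_one]
      simp only [map_mul, map_pow]
      field_simp)
  refine ⟨h1.1, ?_⟩
  rw [e, h1.1, pow_zero, one_mul]

theorem sigmaSeq_three_mul (h : StrippedOrbit a b c d A B α β) (hd : d ≠ 0)
    (hdeg : a * d - b * c + c ^ 2 ≠ 0) :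
    β 2 = 0 ∧ sigmaSeq a b c hd 3 * (ι (X 3) * ι (B 1) * ι (B 2)) = ι (B 3) := by
  have h3 := algebraMap_X_ne_zero 3
  have hp := formB_prime c hd
  have ht := not_formB_dvd_X_three c hd
  obtain ⟨hβ, h2⟩ := h.sigmaSeq_two_mul hd hdeg
  have e : sigmaSeq a b c hd 3 * (ι (X 3) * ι (B 1) * ι (B 2)) = ι (formB c d ^ β 2 * B 3) := by
    have := congrArg (pullFrac a b c hd) h2
    simp only [map_mul, ← sigmaSeq_succ, pullFrac_algebraMap, pullHom_X_three, h.pullHom_B 0,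
      h.pullHom_B 1, zero_add, hβ, pow_zero, one_mul] at this
    rw [map_mul, ← this, h.B_one]
  have h1 := (isUnitAt_sigmaSeq_three_mul a b c hd hdeg).cancel hp (i := β 2) (j := 0)
    (h.not_dvd_B 1) (g := X 3 ^ 2 * B 2)
    (fun hdvd => (hp.dvd_or_dvd hdvd).elim (fun h => ht (hp.dvd_of_dvd_pow h)) (h.not_dvd_B 0))
    (by
      rw [← e, sigmaSeq_one, h.B_one]
      simp only [map_mul, map_pow]
      field_simp)
  refine ⟨h1.1, ?_⟩
  rw [e, h1.1, pow_zero, one_mul]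

theorem sigmaSeq_add_four_mul (h : StrippedOrbit a b c d A B α β) (hd : d ≠ 0)
    (hdeg : a * d - b * c + c ^ 2 ≠ 0) (n : ℕ) :
    sigmaSeq a b c hd (n + 4) * (ι (X 3) * ι (B (n + 2)) * ι (B (n + 3))) =
      ι (B (n + 1)) * ι (B (n + 4)) := by
  have h3 := algebraMap_X_ne_zero 3
  have hB := algebraMap_formB_ne_zero c hd
  have hp := formB_prime c hd
  have ht := not_formB_dvd_X_three c hd
  have hnd {f g : HPoly} (hf : ¬ formB c d ∣ f) (hg : ¬ formB c d ∣ g) : ¬ formB c d ∣ f * g :=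
    fun hdvd => (hp.dvd_or_dvd hdvd).elim hf hg
  induction n with
  | zero =>
    obtain ⟨hβ1, -⟩ := h.sigmaSeq_two_mul hd hdeg
    obtain ⟨hβ, h2⟩ := h.sigmaSeq_three_mul hd hdeg
    have e := congrArg (pullFrac a b c hd) h2
    simp only [map_mul, ← sigmaSeq_succ, pullFrac_algebraMap, pullHom_X_three, h.pullHom_B 0,
      h.pullHom_B 1, h.pullHom_B 2, zero_add, hβ, hβ1, pow_zero, one_mul] at e
    -- The exponent `2` collects one `B₁` from the pull-back of `t B₁` and one from the simple zero
    -- of `σ₄`.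
    have h1 := (isUnitAt_sigmaSeq_four_div a b c hd hdeg).cancel hp (i := β 3) (j := 2)
      (h.not_dvd_B 2) (g := B 2 * B 3) (hnd (h.not_dvd_B 0) (h.not_dvd_B 1))
      (by
        rw [map_mul, ← e, sigmaSeq_one]
        simp only [map_mul, map_pow]
        field_simp)
    rw [zero_add, zero_add, zero_add, zero_add, h1.2, sigmaSeq_one, h.B_one, map_mul]
    field_simp
  | succ n ih =>
    have e := congrArg (pullFrac a b c hd) ih
    simp only [map_mul, ← sigmaSeq_succ, pullFrac_algebraMap, pullHom_X_three, h.pullHom_B n,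
      h.pullHom_B (n + 1), h.pullHom_B (n + 2), h.pullHom_B (n + 3)] at e
    -- From `σ₅` on the order is `0`, so the powers of `B₁` on both sides must balance; the `1`
    -- comes from the pull-back of `t`.
    have h1 := (isUnitAt_sigmaSeq a b c hd hdeg n).cancel hp
      (i := β (n + 1) + β (n + 4)) (j := 1 + β (n + 2) + β (n + 3))
      (f := B (n + 2) * B (n + 5)) (g := X 3 * B (n + 3) * B (n + 4))
      (hnd (h.not_dvd_B n) (h.not_dvd_B (n + 3)))
      (hnd (hnd ht (h.not_dvd_B (n + 1))) (h.not_dvd_B (n + 2)))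
      (by
        simp only [pow_add, map_mul, pow_one]
        linear_combination -e)
    simpa only [map_mul] using h1.2.symm

end StrippedOrbit

theorem sigmaSeq_ne_zero (a b c : ℂ) {d : ℂ} (hd : d ≠ 0) (n : ℕ) : sigmaSeq a b c hd n ≠ 0 := by
  induction n with
  | zero =>
    refine div_ne_zero ?_ (algebraMap_X_ne_zero 3)
    rw [Ne, FaithfulSMul.algebraMap_eq_zero_iff]
    exact formC_ne_zero c hd
  | succ n ih =>
    rw [sigmaSeq_succ]
    exact (map_ne_zero _).2 ih

/-- This is the Painlevé recurrence multiplied by `σ_{n+3}`, rewritten in terms of `ξ` and divided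
by `d`; it is the first formula of `φ̃` in affine form. -/
theorem xiSeq_recurrence (a b c : ℂ) {d : ℂ} (hd : d ≠ 0) (n : ℕ) :
    xiSeq a b c hd (n + 3) * sigmaSeq a b c hd (n + 3) =
      -(ι (C a)) - ι (C b) * (xiSeq a b c hd (n + 2) + xiSeq a b c hd (n + 1))
        - ι (C c) * (xiSeq a b c hd (n + 2) + xiSeq a b c hd (n + 1) + xiSeq a b c hd n)
        - ι (C d) * ((xiSeq a b c hd (n + 2) + xiSeq a b c hd (n + 1)) *
          (2 * xiSeq a b c hd (n + 2) + 2 * xiSeq a b c hd (n + 1) + xiSeq a b c hd n)) := by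
  have hd' : ι (C d) ≠ 0 := by
    rw [Ne, FaithfulSMul.algebraMap_eq_zero_iff, C_eq_zero]
    exact hd
  have h := sigmaSeq_recurrence a b c hd (n + 2)
  have h0 := sigmaSeq_ne_zero a b c hd (n + 2 + 1)
  rw [eq_sub_iff_add_eq, ← mul_left_inj' h0, add_mul, div_mul_cancel₀ _ h0] at h
  have e4 : sigmaSeq a b c hd (n + 2 + 2) = _ := sigmaSeq_eq_xiSeq a b c hd (n + 2)
  have e3 : sigmaSeq a b c hd (n + 2 + 1) = _ := sigmaSeq_eq_xiSeq a b c hd (n + 1)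
  have e2 : sigmaSeq a b c hd (n + 2) = _ := sigmaSeq_eq_xiSeq a b c hd n
  have h4 : ι (C 4) = 4 := by rw [map_ofNat, map_ofNat]
  rw [e4, e3, e2] at h
  rw [show n + 3 = n + 2 + 1 by ring, e3]
  simp only [map_add, map_sub, map_mul, map_pow, h4] at h
  apply mul_left_cancel₀ hd'
  linear_combination h

/-! ### Primitive quadruples and coprimality -/

theorem dvd_of_dvd_mul_of_isRelPrime {R : Type*} [CommRing R] [IsDomain R]
    [UniqueFactorizationMonoid R] {h e x y : R} (hxy : IsRelPrime x y) (hx : h ∣ e * x)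
    (hy : h ∣ e * y) : h ∣ e := by
  classical
  let := UniqueFactorizationMonoid.toGCDMonoid R
  have h1 : h ∣ gcd (e * x) (e * y) := dvd_gcd hx hy
  have h2 : h ∣ e * gcd x y := h1.trans (gcd_mul_left' e x y).dvd
  have h3 : IsUnit (gcd x y) := hxy (gcd_dvd_left x y) (gcd_dvd_right x y)
  exact (h3.dvd_mul_right).1 h2

/-- Once `F` and `G` are made coprime, each divides all components of the opposite quadruple, hence
is constant. This is the uniqueness of a regularised iterate. -/
theorem smul_of_mul_eq_mul_of_primitive {σ τ k : Type*} [Field k] {P Q : τ → MvPolynomial σ k}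
    {F G : MvPolynomial σ k} (hF : F ≠ 0) (hG : G ≠ 0) (h : ∀ i, F * P i = G * Q i)
    (hP : ∀ f, (∀ i, f ∣ P i) → IsUnit f) (hQ : ∀ f, (∀ i, f ∣ Q i) → IsUnit f) :
    ∃ u : k, u ≠ 0 ∧ P = u • Q := by
  obtain ⟨F', G', e, hrel, rfl, rfl⟩ := UniqueFactorizationMonoid.exists_reduced_factors F hF G
  have he : e ≠ 0 := left_ne_zero_of_mul hF
  have h1 (i : τ) : F' * P i = G' * Q i := by
    apply mul_left_cancel₀ he
    rw [← mul_assoc, h, mul_assoc]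
  obtain ⟨r, hr, hr'⟩ := isUnit_iff_eq_C_of_isReduced.1 (hQ F' fun i =>
    hrel.dvd_of_dvd_mul_left (Dvd.intro _ (h1 i)))
  obtain ⟨s, hs, hs'⟩ := isUnit_iff_eq_C_of_isReduced.1 (hP G' fun i =>
    hrel.symm.dvd_of_dvd_mul_left (Dvd.intro _ (h1 i).symm))
  refine ⟨r⁻¹ * s, mul_ne_zero (inv_ne_zero hr.ne_zero) hs.ne_zero, ?_⟩
  ext1 i
  have h2 := h1 i
  rw [hr', hs', ← smul_eq_C_mul, ← smul_eq_C_mul] at h2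
  rw [Pi.smul_apply, mul_smul, ← h2, smul_smul, inv_mul_cancel₀ hr.ne_zero, one_smul]

theorem isRegularizedIterate_iff {a b c d : ℂ} {k : ℕ} {F : HPoly} {Q : Fin 4 → HPoly}
    (hF : F ≠ 0) (h : (phi a b c d)^[k] genPt = F • Q)
    (hQ : ∀ f : HPoly, (∀ i, f ∣ Q i) → IsUnit f) (P : Fin 4 → HPoly) :
    IsRegularizedIterate a b c d k P ↔ ∃ u : ℂ, u ≠ 0 ∧ P = u • Q := by
  constructor
  · rintro ⟨⟨G, hG, hGP⟩, hP⟩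
    refine smul_of_mul_eq_mul_of_primitive hG hF (fun i => ?_) hP hQ
    rw [← hGP, h, Pi.smul_apply, smul_eq_mul]
  · rintro ⟨u, hu, rfl⟩
    refine ⟨⟨u⁻¹ • F, smul_ne_zero (inv_ne_zero hu) hF, fun i => ?_⟩, fun f hf => hQ f fun i => ?_⟩
    · rw [h, Pi.smul_apply, Pi.smul_apply, smul_mul_smul_comm, inv_mul_cancel₀ hu, one_smul,
        smul_eq_mul]
    · have := (hf i).mul_left (C u⁻¹)
      rwa [Pi.smul_apply, smul_eq_C_mul, ← mul_assoc, ← C_mul, inv_mul_cancel₀ hu, C_1,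
        one_mul] at this

theorem not_X_three_dvd_formC (c : ℂ) {d : ℂ} (hd : d ≠ 0) : ¬ X 3 ∣ formC c d := by
  rintro ⟨g, hg⟩
  have h := congrArg (eval ![0, 0, 1, 0]) hg
  rw [eval_formC, map_mul, eval_X] at h
  simp [hd] at h

theorem pullInv_X_three (a b c d : ℂ) : pullInv a b c d (X 3) = X 3 * formC c d := by
  simp [pullInv, psi, phi, lam, genPt, formC]

theorem pullInv_dvd_of_pullHom_eq {a b c d : ℂ} {f g : HPoly} {i n : ℕ} (hf : f.IsHomogeneous n)
    (h : pullHom a b c d f = formB c d ^ i * g) : pullInv a b c d g ∣ formC c d ^ (3 * n) * f := by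
  rw [← pullInv_pullHom a b c d hf, h, map_mul]
  exact dvd_mul_left _ _

namespace StrippedOrbit

variable {a b c d : ℂ} {A B : ℕ → HPoly} {α β : ℕ → ℕ}

/-- Descent by `ψ̃`: a common factor pulls back to a divisor of a power of `C₁` times each member of
the preceding, coprime pair. So its pull-back divides a power of `C₁`, and since it is prime to `B₁`
it is constant. -/
theorem isRelPrime_A_B (h : StrippedOrbit a b c d A B α β) (hd : d ≠ 0) (j k : ℕ) :
    IsRelPrime (A (j + k)) (B (j + 1)) := by
  induction j with
  | zero =>
    rw [h.B_one]
    exact ((formB_prime c hd).irreducible.isRelPrime_iff_not_dvd.2 (h.not_dvd_A _)).symm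
  | succ j ih =>
    intro f hfA hfB
    obtain ⟨m, hm⟩ := h.A_isHomogeneous (j + k)
    obtain ⟨n, hn⟩ := h.B_isHomogeneous j
    have hA := pullInv_dvd_of_pullHom_eq hm (h.pullHom_A (j + k))
    have hB := pullInv_dvd_of_pullHom_eq hn (h.pullHom_B j)
    rw [show j + 1 + k = j + k + 1 by ring] at hfA
    have hA' := (map_dvd (pullInv a b c d) hfA).trans hA
    have hB' := (map_dvd (pullInv a b c d) hfB).trans hB
    refine isUnit_of_pullInv_dvd a b c hd (N := 3 * m + 3 * n)
      (dvd_of_dvd_mul_of_isRelPrime ih (hA'.trans ?_) (hB'.trans ?_))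
      fun hdvd => h.not_dvd_A _ (hdvd.trans hfA)
    · rw [pow_add, mul_right_comm]; exact dvd_mul_right _ _
    · rw [pow_add, mul_assoc]; exact dvd_mul_left _ _

theorem not_X_three_dvd_A (h : StrippedOrbit a b c d A B α β) (hd : d ≠ 0) (k : ℕ) :
    ¬ X 3 ∣ A k := by
  induction k with
  | zero => rw [h.A_zero, X_dvd_X]; decide
  | succ k ih =>
    intro hdvd
    obtain ⟨m, hm⟩ := h.A_isHomogeneous k
    have h1 := (map_dvd (pullInv a b c d) hdvd).trans
      (pullInv_dvd_of_pullHom_eq hm (h.pullHom_A k))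
    rw [pullInv_X_three] at h1
    have hX : Prime (X 3 : HPoly) := X_prime
    rcases hX.dvd_or_dvd ((dvd_mul_right _ _).trans h1) with h2 | h2
    · exact not_X_three_dvd_formC c hd (hX.dvd_of_dvd_pow h2)
    · exact ih h2

theorem isRelPrime_A_Gam (h : StrippedOrbit a b c d A B α β) (hd : d ≠ 0) (k : ℕ) :
    IsRelPrime (A k) (Gam B k) := by
  refine IsRelPrime.mul_right ?_ (IsRelPrime.prod_right fun j hj => ?_)
  · exact (X_prime.irreducible.isRelPrime_iff_not_dvd.2 (h.not_X_three_dvd_A hd k)).symm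
  · obtain ⟨h1, h2⟩ := Finset.mem_Icc.1 hj
    obtain ⟨i, rfl⟩ := Nat.exists_eq_add_of_le' h1
    obtain ⟨l, rfl⟩ := Nat.exists_eq_add_of_le (show i ≤ k by omega)
    exact h.isRelPrime_A_B hd i l

/-! ### Pull-backs and direct images of the stable form -/

theorem alpha_zero (h : StrippedOrbit a b c d A B α β) (hd : d ≠ 0)
    (hdeg : a * d - b * c + c ^ 2 ≠ 0) : α 0 = 0 := by
  rw [h.alpha_eq_sum hd hdeg]; simp

theorem alpha_succ (h : StrippedOrbit a b c d A B α β) (hd : d ≠ 0)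
    (hdeg : a * d - b * c + c ^ 2 ≠ 0) (k : ℕ) : α (k + 1) = α k + β (k + 1) := by
  rw [h.alpha_eq_sum hd hdeg, h.alpha_eq_sum hd hdeg, Finset.sum_Icc_succ_top (by omega)]

theorem A_one (h : StrippedOrbit a b c d A B α β) (hd : d ≠ 0)
    (hdeg : a * d - b * c + c ^ 2 ≠ 0) : A 1 = phi a b c d genPt 0 := by
  have := h.pullHom_A 0
  rw [h.A_zero, h.alpha_zero hd hdeg, pullHom_X_zero] at this
  simpa using this.symm

theorem phi_genPt (h : StrippedOrbit a b c d A B α β) (hd : d ≠ 0)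
    (hdeg : a * d - b * c + c ^ 2 ≠ 0) :
    phi a b c d genPt = ![A 1, X 0 * B 1, X 1 * B 1, X 3 * B 1] := by
  rw [h.A_one hd hdeg, h.B_one]
  ext1 i
  fin_cases i <;> rfl

theorem pullHom_stableForm (h : StrippedOrbit a b c d A B α β) (hd : d ≠ 0)
    (hdeg : a * d - b * c + c ^ 2 ≠ 0) (k : ℕ) (i : Fin 4) :
    pullHom a b c d (stableForm A B (k + 2) i) =
      formB c d ^ α (k + 2) * stableForm A B (k + 3) i := by
  have h1 := h.alpha_succ hd hdeg k
  have h2 := h.alpha_succ hd hdeg (k + 1)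
  have hA0 := h.pullHom_A k
  have hA1 := h.pullHom_A (k + 1)
  have hA2 := h.pullHom_A (k + 2)
  have hB1 := h.pullHom_B k
  have hB2 := h.pullHom_B (k + 1)
  have hG := h.pullHom_Gam (k + 2)
  rw [← h.alpha_eq_sum hd hdeg] at hG
  fin_cases i
  · exact hA2
  · change pullHom a b c d (A (k + 1) * B (k + 2)) = _ * (A (k + 2) * B (k + 3))
    rw [map_mul, hA1, hB2, h2, pow_add]; ring
  · change pullHom a b c d (A k * B (k + 1) * B (k + 2)) = _ * (A (k + 1) * B (k + 2) * B (k + 3))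
    rw [map_mul, map_mul, hA0, hB1, hB2, h2, h1, pow_add, pow_add]; ring
  · exact hG

/-- Applying `φ̃` to its own formulae is the same as pulling them back, and nothing is stripped here
because `α 1 = β 1 = 0`. -/
theorem phi_first (h : StrippedOrbit a b c d A B α β) (hd : d ≠ 0)
    (hdeg : a * d - b * c + c ^ 2 ≠ 0) :
    phi a b c d ![A 1, X 0 * B 1, X 1 * B 1, X 3 * B 1] = stableForm A B 2 := by
  have hβ := (h.sigmaSeq_two_mul hd hdeg).1
  have hα : α 1 = 0 := by rw [h.alpha_succ hd hdeg, h.alpha_zero hd hdeg, hβ]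
  have hA := h.pullHom_A 1
  have hB := h.pullHom_B 0
  rw [hα, pow_zero, one_mul] at hA
  rw [zero_add, hβ, pow_zero, one_mul] at hB
  have key (i : Fin 4) : phi a b c d (phi a b c d genPt) i =
      pullHom a b c d (phi a b c d genPt i) := by
    rw [map_phi]
    congr 1
    ext1 j
    simp [pullHom, genPt]
  rw [← h.phi_genPt hd hdeg]
  ext1 i
  rw [key, h.phi_genPt hd hdeg]
  fin_cases i
  · exact hA
  · change pullHom a b c d (X 0 * B 1) = A 1 * B 2
    rw [map_mul, hB, pullHom_X_zero, h.A_one hd hdeg]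
  · change pullHom a b c d (X 1 * B 1) = A 0 * B 1 * B 2
    rw [map_mul, hB, pullHom_X_one, h.A_zero, h.B_one]
  · change pullHom a b c d (X 3 * B 1) = Gam B 2
    rw [map_mul, hB, pullHom_X_three, Gam_succ, Gam_succ, Gam_zero, h.B_one]

theorem phi_second (h : StrippedOrbit a b c d A B α β) (hd : d ≠ 0)
    (hdeg : a * d - b * c + c ^ 2 ≠ 0) :
    phi a b c d (stableForm A B 2) = stableForm A B 3 := by
  have hα : α 2 = 0 := by
    rw [h.alpha_succ hd hdeg, h.alpha_succ hd hdeg, h.alpha_zero hd hdeg,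
      (h.sigmaSeq_two_mul hd hdeg).1, (h.sigmaSeq_three_mul hd hdeg).1]
  have h2 : stableForm A B 2 = fun i => pullHom a b c d (phi a b c d genPt i) := by
    ext1 i
    rw [← h.phi_first hd hdeg, ← h.phi_genPt hd hdeg, map_phi]
    congr 1
    ext1 j
    simp [pullHom, genPt]
  ext1 i
  have h3 := h.pullHom_stableForm hd hdeg 0 i
  rw [zero_add, hα, pow_zero, one_mul] at h3
  rw [← h3, ← h.phi_first hd hdeg, ← h.phi_genPt hd hdeg, map_phi, h.phi_genPt hd hdeg,
    h.phi_first hd hdeg, h2, h.phi_genPt hd hdeg]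

/-- The denominator `t B_{n+2} B_{n+3}` of `σ_{n+4}` cancels against `Γ_{n+3}`. What remains of
`Γ_{n+3}` ends in `B_{n+1}`, and the numerator supplies a second `B_{n+1}`: this is the square in
the direct factor. -/
theorem directFactor_mul (h : StrippedOrbit a b c d A B α β) (hd : d ≠ 0)
    (hdeg : a * d - b * c + c ^ 2 ≠ 0) (n : ℕ) :
    ι (Gam B (n + 3)) * sigmaSeq a b c hd (n + 4) = ι (directFactor B (n + 3) * B (n + 4)) := by
  have h1 := h.sigmaSeq_add_four_mul hd hdeg n
  have h2 : Gam B (n + 3) =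
      (∏ j ∈ Finset.Icc 1 n, B j) * B (n + 1) * (X 3 * B (n + 2) * B (n + 3)) := by
    rw [Gam_succ, Gam_succ, Gam_succ, Gam]; ring
  have h3 : directFactor B (n + 3) = (∏ j ∈ Finset.Icc 1 n, B j) * B (n + 1) ^ 2 := rfl
  rw [h2, h3]
  simp only [map_mul, map_pow] at h1 ⊢
  linear_combination ι (∏ j ∈ Finset.Icc 1 n, B j) * ι (B (n + 1)) * h1

theorem algebraMap_stableForm (h : StrippedOrbit a b c d A B α β) (hd : d ≠ 0)
    (hdeg : a * d - b * c + c ^ 2 ≠ 0) (k : ℕ) :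
    ι (A (k + 2)) = xiSeq a b c hd (k + 2) * ι (Gam B (k + 2)) ∧
    ι (A (k + 1) * B (k + 2)) = xiSeq a b c hd (k + 1) * ι (Gam B (k + 2)) ∧
    ι (A k * B (k + 1) * B (k + 2)) = xiSeq a b c hd k * ι (Gam B (k + 2)) := by
  refine ⟨h.algebraMap_A_eq hd hdeg _, ?_, ?_⟩
  · rw [map_mul, h.algebraMap_A_eq hd hdeg, Gam_succ B (k + 1), map_mul]; ring
  · rw [map_mul, map_mul, h.algebraMap_A_eq hd hdeg, Gam_succ B (k + 1), Gam_succ B k, map_mul,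
      map_mul]
    ring

theorem linear_relation (h : StrippedOrbit a b c d A B α β) (hd : d ≠ 0)
    (hdeg : a * d - b * c + c ^ 2 ≠ 0) (n : ℕ) :
    C d * (A (n + 3) + A (n + 2) * B (n + 3)) + C c * Gam B (n + 3) =
      directFactor B (n + 3) * B (n + 4) := by
  apply FaithfulSMul.algebraMap_injective HPoly (FractionRing HPoly)
  obtain ⟨h0, h1, -⟩ := h.algebraMap_stableForm hd hdeg (n + 1)
  have hs : sigmaSeq a b c hd (n + 4) = _ := sigmaSeq_eq_xiSeq a b c hd (n + 2)
  rw [← h.directFactor_mul hd hdeg, hs, map_add, map_mul (ι) (C d), map_add, h0, h1, map_mul]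
  ring

theorem phi_stableForm_zero (h : StrippedOrbit a b c d A B α β) (hd : d ≠ 0)
    (hdeg : a * d - b * c + c ^ 2 ≠ 0) (n : ℕ) :
    phi a b c d (stableForm A B (n + 3)) 0 = directFactor B (n + 3) * A (n + 4) := by
  apply FaithfulSMul.algebraMap_injective HPoly (FractionRing HPoly)
  obtain ⟨h0, h1, h2⟩ := h.algebraMap_stableForm hd hdeg (n + 1)
  have hx := xiSeq_recurrence a b c hd (n + 1)
  have hF := h.directFactor_mul hd hdeg n
  have hA : ι (directFactor B (n + 3) * A (n + 4)) =
      ι (Gam B (n + 3)) ^ 2 * (xiSeq a b c hd (n + 4) * sigmaSeq a b c hd (n + 4)) := by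
    rw [map_mul] at hF
    rw [map_mul, h.algebraMap_A_eq hd hdeg, Gam_succ, map_mul]
    linear_combination (-xiSeq a b c hd (n + 4) * ι (Gam B (n + 3))) * hF
  have hphi : phi a b c d (stableForm A B (n + 3)) 0 =
      -(C a * Gam B (n + 3) ^ 2) - C b * ((A (n + 3) + A (n + 2) * B (n + 3)) * Gam B (n + 3))
        - C c * ((A (n + 3) + A (n + 2) * B (n + 3) + A (n + 1) * B (n + 2) * B (n + 3))
          * Gam B (n + 3))
        - C d * ((A (n + 3) + A (n + 2) * B (n + 3)) * (2 * A (n + 3)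
          + 2 * (A (n + 2) * B (n + 3)) + A (n + 1) * B (n + 2) * B (n + 3))) := by
    rw [← smul_eq_C_mul, ← smul_eq_C_mul, ← smul_eq_C_mul, ← smul_eq_C_mul]
    rfl
  rw [hA, hphi, hx]
  have e2 : ι 2 = 2 := map_ofNat _ 2
  simp only [map_add, map_sub, map_neg, map_pow, map_mul ι (C _),
    map_mul ι _ (Gam B (n + 3)), h0, h1, h2]
  simp only [map_mul ι (A (n + 3) + A (n + 2) * B (n + 3)), map_add, h0, h1, h2,
    map_mul ι 2, e2]
  ring

theorem phi_stableForm (h : StrippedOrbit a b c d A B α β) (hd : d ≠ 0)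
    (hdeg : a * d - b * c + c ^ 2 ≠ 0) (n : ℕ) :
    phi a b c d (stableForm A B (n + 3)) = directFactor B (n + 3) • stableForm A B (n + 4) := by
  have hl := h.linear_relation hd hdeg n
  have hS : c • Gam B (n + 3) + d • (A (n + 3) + A (n + 2) * B (n + 3)) =
      directFactor B (n + 3) * B (n + 4) := by
    rw [smul_eq_C_mul, smul_eq_C_mul, ← hl]; ring
  ext1 i
  fin_cases i
  · exact h.phi_stableForm_zero hd hdeg n
  · change A (n + 3) * (c • Gam B (n + 3) + d • (A (n + 3) + A (n + 2) * B (n + 3))) =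
      directFactor B (n + 3) * (A (n + 3) * B (n + 4))
    rw [hS]; ring
  · change A (n + 2) * B (n + 3) *
        (c • Gam B (n + 3) + d • (A (n + 3) + A (n + 2) * B (n + 3))) =
      directFactor B (n + 3) * (A (n + 2) * B (n + 3) * B (n + 4))
    rw [hS]; ring
  · change Gam B (n + 3) * (c • Gam B (n + 3) + d • (A (n + 3) + A (n + 2) * B (n + 3))) =
      directFactor B (n + 3) * Gam B (n + 4)
    rw [hS, Gam_succ B (n + 3)]; ring

theorem B_ne_zero (h : StrippedOrbit a b c d A B α β) (hd : d ≠ 0) (k : ℕ) : B (k + 1) ≠ 0 := by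
  rcases k with _ | k
  · rw [zero_add, h.B_one]; exact formB_ne_zero c hd
  · exact fun h0 => h.not_dvd_B k (h0 ▸ dvd_zero _)

theorem directFactor_ne_zero (h : StrippedOrbit a b c d A B α β) (hd : d ≠ 0) (n : ℕ) :
    directFactor B (n + 3) ≠ 0 := by
  refine mul_ne_zero (Finset.prod_ne_zero_iff.2 fun j hj => ?_) (pow_ne_zero _ (h.B_ne_zero hd n))
  obtain ⟨i, rfl⟩ := Nat.exists_eq_add_of_le' (Finset.mem_Icc.1 hj).1
  exact h.B_ne_zero hd i

theorem exists_iterate_eq (h : StrippedOrbit a b c d A B α β) (hd : d ≠ 0)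
    (hdeg : a * d - b * c + c ^ 2 ≠ 0) (n : ℕ) :
    ∃ F : HPoly, F ≠ 0 ∧ (phi a b c d)^[n + 2] genPt = F • stableForm A B (n + 2) := by
  have h2 : (phi a b c d)^[2] genPt = stableForm A B 2 := by
    rw [Function.iterate_succ_apply', Function.iterate_one, h.phi_genPt hd hdeg,
      h.phi_first hd hdeg]
  induction n with
  | zero => exact ⟨1, one_ne_zero, by rw [one_smul, zero_add, h2]⟩
  | succ n ih =>
    rcases n with _ | n
    · refine ⟨1, one_ne_zero, ?_⟩
      rw [one_smul, ← h.phi_second hd hdeg, ← h2]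
      rfl
    · obtain ⟨F, hF, hF'⟩ := ih
      refine ⟨F ^ 2 * directFactor B (n + 3),
        mul_ne_zero (pow_ne_zero _ hF) (h.directFactor_ne_zero hd n), ?_⟩
      rw [show n + 1 + 1 + 2 = n + 1 + 2 + 1 by ring, Function.iterate_succ_apply', hF', phi_smul,
        h.phi_stableForm hd hdeg, smul_smul]

end StrippedOrbit

/-! ### The full statement -/

theorem theorem2 (a b c d : ℂ) (hd : d ≠ 0) (hdeg : a * d - b * c + c ^ 2 ≠ 0) :
    -- the polynomials `A_k`, `B_k` and the stable form
    (∃ (A B : ℕ → HPoly) (α β : ℕ → ℕ),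
      -- initial data
      A 0 = X 0 ∧
      A 1 = phi a b c d genPt 0 ∧
      B 1 = formB c d ∧
      -- `p₁ = [A₁, x B₁, y B₁, t B₁]`
      (∀ P : Fin 4 → HPoly, IsRegularizedIterate a b c d 1 P ↔
        ∃ u : ℂ, u ≠ 0 ∧ P = u • ![A 1, X 0 * B 1, X 1 * B 1, X 3 * B 1]) ∧
      -- `p_k = [A_k, A_{k-1} B_k, A_{k-2} B_{k-1} B_k, t B₁ ⋯ B_k]`
      (∀ k : ℕ, 2 ≤ k → ∀ P : Fin 4 → HPoly, IsRegularizedIterate a b c d k P ↔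
        ∃ u : ℂ, u ≠ 0 ∧ P = u • stableForm A B k) ∧
      -- direct images
      phi a b c d genPt = ![A 1, X 0 * B 1, X 1 * B 1, X 3 * B 1] ∧
      phi a b c d ![A 1, X 0 * B 1, X 1 * B 1, X 3 * B 1] = stableForm A B 2 ∧
      phi a b c d (stableForm A B 2) = stableForm A B 3 ∧
      (∀ k : ℕ, 3 ≤ k →
        phi a b c d (stableForm A B k) = directFactor B k • stableForm A B (k + 1)) ∧
      -- recurrence for `B`
      (∀ k : ℕ, 3 ≤ k →
        d • Dpol A B k + c • Gam B k - directFactor B k * B (k + 1) = 0) ∧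
      -- recurrence for `A`
      (∀ k : ℕ, 3 ≤ k →
        A (k + 1) * directFactor B k + a • Gam B k ^ 2
          + B k * Dpol A B (k - 1) * (d • Dpol A B k + c • Gam B k)
          + Dpol A B k * (b • Gam B k + d • (Dpol A B k + A k))
          + c • (A k * Gam B k) = 0) ∧
      -- pull-backs of `A_k` and `B_k`: the extra factors are powers of `B₁`
      (∀ k : ℕ, pullback a b c d (A k) = B 1 ^ α k * A (k + 1)) ∧
      (∀ k : ℕ, 1 ≤ k → pullback a b c d (B k) = B 1 ^ β k * B (k + 1)) ∧
      (∀ k : ℕ, ¬ B 1 ∣ A k) ∧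
      (∀ k : ℕ, 2 ≤ k → ¬ B 1 ∣ B k) ∧
      (∀ k : ℕ, 1 ≤ k → α k = α (k - 1) + β k) ∧
      -- pull-back of `p_k`
      (∀ k : ℕ, 2 ≤ k → ∀ i, pullback a b c d (stableForm A B k i)
        = B 1 ^ α k * stableForm A B (k + 1) i)) ∧
    -- pull-back of any irreducible surface `S = {E = 0}`: the only extra factors are powers of `B₁`
    (∀ (E : HPoly) (n : ℕ), Irreducible E → E.IsHomogeneous n → ¬ Associated E (formC c d) →
      ∃ (ν : ℕ) (E' : HPoly), Irreducible E' ∧ ¬ formB c d ∣ E' ∧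
        pullback a b c d E = formB c d ^ ν * E' ∧ IsImageEquation a b c d E E') ∧
    -- the surface contracted by `ψ̃`
    pullback a b c d (formC c d) = formB c d ^ 2 := by
  refine ⟨?_, fun E n => exists_pullback_eq_pow_mul_irreducible a b c hd E n,
    pullHom_formC a b c d⟩
  obtain ⟨A, B, α, β, h⟩ := exists_strippedOrbit a b c hd
  -- The first and last components alone are coprime, which makes the whole quadruple primitive.
  have prim (k : ℕ) (Q : Fin 4 → HPoly) (h0 : Q 0 = A k) (h3 : Q 3 = Gam B k) (f : HPoly)
      (hf : ∀ i, f ∣ Q i) : IsUnit f :=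
    h.isRelPrime_A_Gam hd k (h0 ▸ hf 0) (h3 ▸ hf 3)
  refine ⟨A, B, α, β, h.A_zero, h.A_one hd hdeg, h.B_one, ?_, ?_, h.phi_genPt hd hdeg,
    h.phi_first hd hdeg, h.phi_second hd hdeg, ?_, ?_, ?_, ?_, ?_, ?_, ?_, ?_, ?_⟩
  · refine isRegularizedIterate_iff one_ne_zero ?_ (prim 1 _ rfl ?_)
    · rw [one_smul, Function.iterate_one, h.phi_genPt hd hdeg]
    · rw [Gam_succ, Gam_zero]; rfl
  · intro k hk
    obtain ⟨n, rfl⟩ := Nat.exists_eq_add_of_le' hk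
    obtain ⟨F, hF, hF'⟩ := h.exists_iterate_eq hd hdeg n
    exact isRegularizedIterate_iff hF hF' (prim (n + 2) _ rfl rfl)
  · intro k hk
    obtain ⟨n, rfl⟩ := Nat.exists_eq_add_of_le' hk
    exact h.phi_stableForm hd hdeg n
  · intro k hk
    obtain ⟨n, rfl⟩ := Nat.exists_eq_add_of_le' hk
    rw [smul_eq_C_mul, smul_eq_C_mul, sub_eq_zero]
    exact h.linear_relation hd hdeg n
  · intro k hk
    obtain ⟨n, rfl⟩ := Nat.exists_eq_add_of_le' hk
    have h1 := h.phi_stableForm_zero hd hdeg n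
    change -(a • Gam B (n + 3) ^ 2) - b • ((A (n + 3) + A (n + 2) * B (n + 3)) * Gam B (n + 3))
        - c • ((A (n + 3) + A (n + 2) * B (n + 3) + A (n + 1) * B (n + 2) * B (n + 3))
          * Gam B (n + 3))
        - d • ((A (n + 3) + A (n + 2) * B (n + 3)) * (2 * A (n + 3)
          + 2 * (A (n + 2) * B (n + 3)) + A (n + 1) * B (n + 2) * B (n + 3))) = _ at h1
    change A (n + 4) * directFactor B (n + 3) + a • Gam B (n + 3) ^ 2
      + B (n + 3) * (A (n + 2) + A (n + 1) * B (n + 2))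
        * (d • (A (n + 3) + A (n + 2) * B (n + 3)) + c • Gam B (n + 3))
      + (A (n + 3) + A (n + 2) * B (n + 3)) * (b • Gam B (n + 3)
        + d • ((A (n + 3) + A (n + 2) * B (n + 3)) + A (n + 3)))
      + c • (A (n + 3) * Gam B (n + 3)) = 0
    simp only [smul_eq_C_mul] at h1 ⊢
    linear_combination -h1
  · exact fun k => h.B_one ▸ h.pullHom_A k
  · intro k hk
    obtain ⟨n, rfl⟩ := Nat.exists_eq_add_of_le' hk
    exact h.B_one ▸ h.pullHom_B n
  · exact fun k => h.B_one ▸ h.not_dvd_A k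
  · intro k hk
    obtain ⟨n, rfl⟩ := Nat.exists_eq_add_of_le' hk
    exact h.B_one ▸ h.not_dvd_B n
  · intro k hk
    obtain ⟨n, rfl⟩ := Nat.exists_eq_add_of_le' hk
    exact h.alpha_succ hd hdeg n
  · intro k hk i
    obtain ⟨n, rfl⟩ := Nat.exists_eq_add_of_le' hk
    exact h.B_one ▸ h.pullHom_stableForm hd hdeg n i
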